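/- **Theorem.** The following problem can be solved in polynomial time. *Input.* A finite (abstract) simplicial complex $K$, given by the list of all its simplices (each as a set of vertices); a nonnegative integer length, written in binary, for each edge of $K$; a dimension $d\ge 0$; and a $d$-dimensional cycle $z_0$ of $K$ over $\mathbb{Z}_2$, which represents the homology class $h=[z_0]\in H_d(K;\mathbb{Z}_2)$. *Output.* A cycle $z_r\in h$ (that is, a $d$-cycle with $[z_r]=h$ in $H_d(K;\mathbb{Z}_2)$) of minimal radius: $\operatorname{rad}(z_r)\le\operatorname{rad}(z)$ for every cycle $z\in h$. Here $\operatorname{dist}(p,q)\in\mathbb{Z}_{\ge 0}\cup\{\infty\}$ is the length of a shortest path between the vertices $p$ and $q$ in the 1-skeleton of $K$ ($\infty$ if there is none), and the radius of a cycle is $$\operatorname{rad}(z)=\min_{p\in \operatorname{vert}(K)}\ \max_{q\in \operatorname{vert}(z)}\operatorname{dist}(p,q),$$ where $\operatorname{vert}(K)$ is the set of vertices of $K$ and $\operatorname{vert}(z)$ is the set of vertices of the simplices that occur in $z$ (the maximum over the empty set being $0$ and the minimum over the empty set being $\infty$). Polynomial time means that a single program of a random access machine, whose elementary steps are assignments,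 additions and truncated subtractions of natural numbers, indexed memory accesses and tests for zero, solves every instance in a number of steps that is bounded by a polynomial in the number of binary digits of the input. -/

import Mathlib

noncomputable section

/-! ### Random access machines with a step count -/

namespace RAM

/-- Memory of a random access machine: registers `reg 0, reg 1, …` and arrays
`arr 0, arr 1, …`, all cells holding natural numbers. A program mentions only finitely many
registers and arrays by name; array cells are addressed through registers. -/
@[ext]
structure State where
  reg : ℕ → ℕ
  arr : ℕ → ℕ → ℕ

/-- The elementary instructions. There is deliberately no multiplication and no shift: in one step
the largest number in memory gains at most one bit (up to the constants of the program), so that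
counting instructions agrees up to a polynomial with the time of a Turing machine. -/
inductive Instr where
  /-- `r := k` -/
  | const (r k : ℕ)
  /-- `r := x` -/
  | copy (r x : ℕ)
  /-- `r := x + y` -/
  | add (r x y : ℕ)
  /-- `r := x - y`, and `0` if `x < y` -/
  | sub (r x y : ℕ)
  /-- `r := a[i]`, the index being the content of register `i` -/
  | load (r a i : ℕ)
  /-- `a[i] := x`, the index being the content of register `i` -/
  | store (a i x : ℕ)

/-- The effect of an elementary instruction. -/
def Instr.apply : Instr → State → State
  | .const r k, s => { s with reg := Function.update s.reg r k }
  | .copy r x, s => { s with reg := Function.update s.reg r (s.reg x) }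
  | .add r x y, s => { s with reg := Function.update s.reg r (s.reg x + s.reg y) }
  | .sub r x y, s => { s with reg := Function.update s.reg r (s.reg x - s.reg y) }
  | .load r a i, s => { s with reg := Function.update s.reg r (s.arr a (s.reg i)) }
  | .store a i x, s =>
      { s with arr := Function.update s.arr a (Function.update (s.arr a) (s.reg i) (s.reg x)) }

/-- Programs: elementary instructions combined by sequencing, by a conditional and by a loop,
the last two testing whether a register is nonzero. -/
inductive Prog where
  | skip
  | instr (i : Instr)
  | seq (c₁ c₂ : Prog)
  | ifNonzero (x : ℕ) (c₁ c₂ : Prog)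
  | whileNonzero (x : ℕ) (c : Prog)

/-- `Run c s s' t`: started in the state `s`, the program `c` halts in the state `s'` after exactly
`t` steps. Every elementary instruction and every test is one step. -/
inductive Run : Prog → State → State → ℕ → Prop
  | skip (s : State) : Run .skip s s 1
  | instr (i : Instr) (s : State) : Run (.instr i) s (i.apply s) 1
  | seq {c₁ c₂ : Prog} {s s' s'' : State} {t₁ t₂ : ℕ} :
      Run c₁ s s' t₁ → Run c₂ s' s'' t₂ → Run (.seq c₁ c₂) s s'' (t₁ + t₂)
  | ifTrue {x : ℕ} {c₁ c₂ : Prog} {s s' : State} {t : ℕ} :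
      s.reg x ≠ 0 → Run c₁ s s' t → Run (.ifNonzero x c₁ c₂) s s' (t + 1)
  | ifFalse {x : ℕ} {c₁ c₂ : Prog} {s s' : State} {t : ℕ} :
      s.reg x = 0 → Run c₂ s s' t → Run (.ifNonzero x c₁ c₂) s s' (t + 1)
  | whileDone {x : ℕ} {c : Prog} {s : State} :
      s.reg x = 0 → Run (.whileNonzero x c) s s 1
  | whileStep {x : ℕ} {c : Prog} {s s' s'' : State} {t₁ t₂ : ℕ} :
      s.reg x ≠ 0 → Run c s s' t₁ → Run (.whileNonzero x c) s' s'' t₂ →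
        Run (.whileNonzero x c) s s'' (t₁ + t₂ + 1)

/-- The initial state on the input word `w`: array `0` holds `w`, register `0` holds its length,
and everything else is `0`. -/
def init (w : List ℕ) : State where
  reg := Function.update 0 0 w.length
  arr := Function.update 0 0 (fun i => w.getD i 0)

/-- The output of a state is the word `w`: register `0` holds the length of `w`, and array `1`
starts with the entries of `w`. -/
def Outputs (s : State) (w : List ℕ) : Prop :=
  s.reg 0 = w.length ∧ ∀ i, ∀ h : i < w.length, s.arr 1 i = w[i]

/-- The size of a word of natural numbers: the number of binary digits of its entries, plus one
separator for each entry. -/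
def size (w : List ℕ) : ℕ := (w.map fun a => Nat.size a + 1).sum

/-- The search problem "given an instance `a`, written as the word `enc a`, find a word `w` with
`Sol a w`" is solvable in polynomial time: one program solves all instances, with a number of
steps bounded by one polynomial in the size of the input word. -/
def PolyTimeSolvable {α : Type} (enc : α → List ℕ) (Sol : α → List ℕ → Prop) : Prop :=
  ∃ (c : Prog) (P : Polynomial ℕ), ∀ a : α, ∃ (s : State) (t : ℕ) (w : List ℕ),
    Run c (init (enc a)) s t ∧ t ≤ P.eval (size (enc a)) ∧ Outputs s w ∧ Sol a w

end RAM

/-! ### Simplicial homology over `ℤ/2` -/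

namespace CycleLocalization

variable {n : ℕ} (K : AbstractSimplicialComplex (Fin n))

/-- The simplices of `K` with exactly `k` vertices, i.e. those of dimension `k - 1`. There are none
for `k = 0`, because simplices are nonempty. -/
abbrev Simplex (k : ℕ) : Type := {σ : Finset (Fin n) // σ ∈ K.faces ∧ σ.card = k}

instance (k : ℕ) : Fintype (Simplex K k) := Fintype.ofFinite _

/-- The mod 2 chains made of simplices with `k` vertices. So `d`-dimensional chains are
`Chain K (d + 1)`. -/
abbrev Chain (k : ℕ) : Type := Simplex K k → ZMod 2

/-- The boundary operator `∂_d` from `d`-dimensional chains to `(d - 1)`-dimensional chains: the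
coefficient of `τ` in `∂ c` is the sum of the coefficients in `c` of the `d`-simplices that contain
`τ`. For `d = 0` the target is the zero space. -/
def boundary (d : ℕ) : Chain K (d + 1) →ₗ[ZMod 2] Chain K d where
  toFun c τ := ∑ σ : Simplex K (d + 1), if τ.1 ⊆ σ.1 then c σ else 0
  map_add' c c' := by
    funext τ
    simp only [Pi.add_apply, ← Finset.sum_add_distrib]
    refine Finset.sum_congr rfl fun σ _ => ?_
    split_ifs <;> simp
  map_smul' a c := by
    funext τ
    simp [Finset.mul_sum]

/-- The group `Z_d(K)` of `d`-dimensional cycles. -/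
abbrev Cycles (d : ℕ) : Submodule (ZMod 2) (Chain K (d + 1)) := LinearMap.ker (boundary K d)

/-- The group `B_d(K)` of `d`-dimensional boundaries. -/
abbrev Boundaries (d : ℕ) : Submodule (ZMod 2) (Chain K (d + 1)) :=
  LinearMap.range (boundary K (d + 1))

/-- The homology group `H_d(K) = Z_d(K) / B_d(K)`. -/
abbrev Homology (d : ℕ) : Type := Cycles K d ⧸ (Boundaries K d).submoduleOf (Cycles K d)

/-- The homology class of a cycle. -/
abbrev homologyClass {d : ℕ} (z : Cycles K d) : Homology K d := Submodule.Quotient.mk z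

/-! ### Geodesic distance and radius -/

/-- The 1-skeleton of `K`. -/
def oneSkeleton : SimpleGraph (Fin n) where
  Adj u v := u ≠ v ∧ ({u, v} : Finset (Fin n)) ∈ K.faces
  symm := ⟨fun u v h => ⟨h.1.symm, by rw [Finset.pair_comm]; exact h.2⟩⟩
  loopless := ⟨fun _ h => h.1 rfl⟩

variable {K}

/-- The edge of `K` that underlies a directed edge of the 1-skeleton. -/
def edgeOfDart (e : (oneSkeleton K).Dart) : Simplex K 2 :=
  ⟨{e.fst, e.snd}, e.adj.2, Finset.card_pair e.adj.1⟩

/-- The length of a path in the 1-skeleton, for given edge lengths. -/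
def pathLength (len : Simplex K 2 → ℕ) {p q : Fin n} (w : (oneSkeleton K).Walk p q) : ℕ :=
  (w.darts.map fun e => len (edgeOfDart e)).sum

/-- The geodesic distance: the length of a shortest path in the 1-skeleton, and `⊤` if there is
no path. -/
def geodist (len : Simplex K 2 → ℕ) (p q : Fin n) : ℕ∞ :=
  ⨅ w : (oneSkeleton K).Walk p q, (pathLength len w : ℕ∞)

/-- The vertices of a chain: the vertices of the simplices that occur in it. -/
def chainVertices {k : ℕ} (c : Chain K k) : Set (Fin n) := {q | ∃ σ, c σ ≠ 0 ∧ q ∈ σ.1}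

/-- The radius `min_p max_q dist(p, q)`, where `p` runs through the vertices of `K` and `q` through
those of the chain. It is `⊤` if no vertex of `K` is at finite distance from all of them. -/
def radius (len : Simplex K 2 → ℕ) {k : ℕ} (c : Chain K k) : ℕ∞ :=
  ⨅ p : Fin n, ⨆ q ∈ chainVertices c, geodist len p q

/-- `z` is a representative cycle of the class `h` whose radius is the least one among all
representative cycles of `h`. -/
def IsMinRadiusCycle (len : Simplex K 2 → ℕ) {d : ℕ} (h : Homology K d) (z : Cycles K d) : Prop :=
  homologyClass K z = h ∧
    ∀ z' : Cycles K d, homologyClass K z' = h → radius len z.1 ≤ radius len z'.1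

/-! ### The computational problem -/

/-- An instance of the problem: a finite simplicial complex with vertex set `Fin n` (every vertex
being a simplex), listed with its simplices in any order, a length for each edge, a dimension `d`,
and a `d`-cycle that represents the homology class in question. -/
structure Instance where
  n : ℕ
  K : AbstractSimplicialComplex (Fin n)
  simplices : List {σ : Finset (Fin n) // σ ∈ K.faces}
  nodup : simplices.Nodup
  complete : ∀ σ, σ ∈ simplices
  len : Simplex K 2 → ℕ
  d : ℕ
  z₀ : Cycles K d

/-- The value at `σ` of a function on the simplices with `k` vertices, extended by zero. -/
def valueAt {M : Type} [Zero M] {k : ℕ} (f : Simplex K k → M)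
    (σ : {σ : Finset (Fin n) // σ ∈ K.faces}) : M :=
  if h : σ.1.card = k then f ⟨σ.1, σ.2, h⟩ else 0

/-- The input word: the number of vertices, the dimension `d`, the number of simplices and then, for
each simplex of the list, the bits that tell which vertices it has, its length if it is an edge
(otherwise `0`), and its coefficient in the given cycle (`0` if its dimension is not `d`). -/
def Instance.encode (I : Instance) : List ℕ :=
  I.n :: I.d :: I.simplices.length :: I.simplices.flatMap fun σ =>
    (List.ofFn fun v : Fin I.n => if v ∈ σ.1 then 1 else 0) ++
      [valueAt I.len σ, (valueAt I.z₀.1 σ).val]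

/-- A `d`-cycle as a word: its coefficients at the simplices, in the order of the list (`0` at the
simplices whose dimension is not `d`). -/
def Instance.encodeCycle (I : Instance) (z : Cycles I.K I.d) : List ℕ :=
  I.simplices.map fun σ => (valueAt z.1 σ).val

/-- A word solves the instance if it describes a cycle of minimal radius in the class of the given
cycle. -/
def Instance.Solution (I : Instance) (w : List ℕ) : Prop :=
  ∃ z : Cycles I.K I.d,
    IsMinRadiusCycle I.len (homologyClass I.K I.z₀) z ∧ w = I.encodeCycle z

end CycleLocalization

end

/-! ### A table language compiled to random access machines

Programs of this language work on finitely many `N × N` tables, `N` being the length of the input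
word. All loops run `N` times, so that every program takes polynomial time. -/

/-! The radius involves two minima, over the representatives of the class and over the centers, and
these can be exchanged. So fix a center `p` and give each simplex as weight the largest distance
from `p` to one of its vertices. It remains to find, in the coset of the given cycle modulo
boundaries, a vector whose heaviest simplex is as light as possible, and then to keep the best
result over all `p`.

For fixed `p` this is Gaussian elimination over `ZMod 2`, with the coordinates treated in order of
decreasing weight. At a coordinate `s`, a row that is nonzero there (if there is one) is added to
every row that is nonzero at `s`, itself included, and to `z` if `z s ≠ 0`. The rows then span the
boundaries that vanish on all treated coordinates. The invariant kept by `EliminationState.step` is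
that a boundary `y` not vanishing on the treated coordinates has in its support a coordinate `s` of
maximal weight with `z s = 0`. At the end this applies to `y = z' - z` for every competitor `z'`:
wherever `z` is nonzero, `z'` is nonzero there too or at some coordinate that is at least as heavy
(`EliminationState.final`).

Distances come from Bellman–Ford relaxation (`Relaxation`), infinity being replaced by a number
`top` above all finite distances. If no center gives a weight below `top`, all representatives have
infinite radius and the given cycle is kept.

For the running time, the algorithm is written in a small language of tables all of whose loops run
`N` times, `N` being the length of the input word. Its programs compile to the machine (`exec_expr`,
`exec_cmd`), and their cost is a polynomial in `N` by structural induction, whatever the values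
stored (`Cmd.polyBounded_cost`). Since `N` is at most the input size, `polyTimeSolvable_of_cmd`
leaves only the correctness of one table program to prove. -/

namespace RAM

/-- `iter f a k` applies `f 0, …, f (k - 1)` successively to `a`. -/
def iter {α : Type} (f : ℕ → α → α) (a : α) : ℕ → α
  | 0 => a
  | k + 1 => f k (iter f a k)

/-- Expressions over the input word and the tables, with de Bruijn variables. -/
inductive Expr where
  | const (k : ℕ)
  | var (i : ℕ)
  /-- the length of the input -/
  | len
  | input (e : Expr)
  | add (e₁ e₂ : Expr)
  | sub (e₁ e₂ : Expr)
  /-- the value of `e₁` if `c` is nonzero and that of `e₂` otherwise -/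
  | ite (c e₁ e₂ : Expr)
  | load (a : ℕ) (e₁ e₂ : Expr)
  /-- starting from `e₀`, update an accumulator (variable `0`) by `e` for each value of the index
  (variable `1`) below the input length -/
  | fold (e₀ e : Expr)

/-- Commands on tables. -/
inductive Cmd where
  /-- Assign to all entries of table `a` simultaneously; in `e` variable `0` is the row and
  variable `1` the column. -/
  | assign (a : ℕ) (e : Expr)
  | seq (c₁ c₂ : Cmd)
  /-- Run `c` for each value of variable `0` below the input length. -/
  | loop (c : Cmd)

/-- The contents of all tables. -/
abbrev Tables : Type := ℕ → ℕ → ℕ → ℕ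

/-- The value of an expression. -/
def Expr.eval (w : List ℕ) (σ : Tables) : Expr → List ℕ → ℕ
  | .const k, _ => k
  | .var i, env => env.getD i 0
  | .len, _ => w.length
  | .input e, env => w.getD (e.eval w σ env) 0
  | .add e₁ e₂, env => e₁.eval w σ env + e₂.eval w σ env
  | .sub e₁ e₂, env => e₁.eval w σ env - e₂.eval w σ env
  | .ite c e₁ e₂, env => if c.eval w σ env ≠ 0 then e₁.eval w σ env else e₂.eval w σ env
  | .load a e₁ e₂, env => σ a (e₁.eval w σ env) (e₂.eval w σ env)
  | .fold e₀ e, env => iter (fun k x => e.eval w σ (x :: k :: env)) (e₀.eval w σ env) w.length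

/-- The table with entries `f i j` for `i, j < N`, continued by zero. -/
def mkTable (N : ℕ) (f : ℕ → ℕ → ℕ) (i j : ℕ) : ℕ := if i < N ∧ j < N then f i j else 0

/-- The effect of a command. -/
def Cmd.exec (w : List ℕ) : Cmd → List ℕ → Tables → Tables
  | .assign a e, env, σ =>
      Function.update σ a (mkTable w.length fun i j => e.eval w σ (i :: j :: env))
  | .seq c₁ c₂, env, σ => c₂.exec w env (c₁.exec w env σ)
  | .loop c, env, σ => iter (fun k σ => c.exec w (k :: env) σ) σ w.length

/-! #### Executions with a time bound -/

/-- Started in `s`, the program `c` halts within `T` steps in a state that satisfies `Q`. -/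
def Exec (c : Prog) (T : ℕ) (s : State) (Q : State → Prop) : Prop :=
  ∃ s' t, Run c s s' t ∧ t ≤ T ∧ Q s'

theorem Exec.mono {c : Prog} {T T' : ℕ} {s : State} {Q Q' : State → Prop} (h : Exec c T s Q)
    (hT : T ≤ T') (hQ : ∀ s', Q s' → Q' s') : Exec c T' s Q' := by
  obtain ⟨s', t, hr, ht, hq⟩ := h
  exact ⟨s', t, hr, ht.trans hT, hQ _ hq⟩

theorem Exec.instr {i : Instr} {s : State} {Q : State → Prop} (h : Q (i.apply s)) :
    Exec (.instr i) 1 s Q :=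
  ⟨_, _, .instr i s, le_rfl, h⟩

theorem Exec.seq {c₁ c₂ : Prog} {T₁ T₂ : ℕ} {s : State} {Q : State → Prop}
    (h : Exec c₁ T₁ s fun s' => Exec c₂ T₂ s' Q) : Exec (.seq c₁ c₂) (T₁ + T₂) s Q := by
  obtain ⟨s', t, hr, ht, s'', t', hr', ht', hq⟩ := h
  exact ⟨s'', _, .seq hr hr', by omega, hq⟩

theorem Exec.ite {x : ℕ} {c₁ c₂ : Prog} {T : ℕ} {s : State} {Q : State → Prop}
    (h₁ : s.reg x ≠ 0 → Exec c₁ T s Q) (h₂ : s.reg x = 0 → Exec c₂ T s Q) :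
    Exec (.ifNonzero x c₁ c₂) (T + 1) s Q := by
  by_cases hx : s.reg x = 0
  · obtain ⟨s', t, hr, ht, hq⟩ := h₂ hx
    exact ⟨s', _, .ifFalse hx hr, by omega, hq⟩
  · obtain ⟨s', t, hr, ht, hq⟩ := h₁ hx
    exact ⟨s', _, .ifTrue hx hr, by omega, hq⟩

/-- Run `body` with register `δ` counting from `0` to the content of register `0`. -/
def forProg (δ : ℕ) (body : Prog) : Prog :=
  .seq (.instr (.const δ 0)) <| .seq (.instr (.copy (δ + 1) 0)) <| .whileNonzero (δ + 1) <|
    .seq body <| .seq (.instr (.const (δ + 2) 1)) <| .seq (.instr (.add δ δ (δ + 2))) <|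
      .instr (.sub (δ + 1) (δ + 1) (δ + 2))

theorem exec_while {x N T : ℕ} {body : Prog} (P : ℕ → State → Prop)
    (hbody : ∀ k < N, ∀ s, P k s → s.reg x = N - k →
      Exec body T s fun s' => P (k + 1) s' ∧ s'.reg x = N - (k + 1)) :
    ∀ j k s, k + j = N → P k s → s.reg x = j →
      Exec (.whileNonzero x body) (j * (T + 1) + 1) s fun s' => P N s' := by
  intro j
  induction j with
  | zero =>
    intro k s hk hP hx
    exact ⟨s, 1, .whileDone hx, by omega, by simpa [← hk] using hP⟩
  | succ j ih =>
    intro k s hk hP hx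
    obtain ⟨s₁, t₁, hr₁, ht₁, hP₁, hx₁⟩ := hbody k (by omega) s hP (by omega)
    obtain ⟨s₂, t₂, hr₂, ht₂, hP₂⟩ := ih (k + 1) s₁ (by omega) hP₁ (by omega)
    refine ⟨s₂, _, .whileStep (by omega) hr₁ hr₂, ?_, hP₂⟩
    rw [Nat.succ_mul]
    omega

/-- Registers `δ`, `δ + 1`, `δ + 2` hold the index, a countdown and the constant `1`. By `hcongr`
the invariant sees only the arrays and the registers below `δ`, so this bookkeeping cannot destroy
it. The constant is set anew in each round, which is why the body need only preserve the first two.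
-/
theorem exec_for {δ N T : ℕ} {body : Prog} {s : State} (P : ℕ → State → Prop) (hδ : 0 < δ)
    (hN : s.reg 0 = N)
    (hcongr : ∀ k s s', P k s → s'.arr = s.arr → (∀ r < δ, s'.reg r = s.reg r) → P k s')
    (h0 : P 0 s)
    (hbody : ∀ k < N, ∀ s, P k s → s.reg δ = k → Exec body T s fun s' =>
      P (k + 1) s' ∧ s'.reg δ = s.reg δ ∧ s'.reg (δ + 1) = s.reg (δ + 1)) :
    Exec (forProg δ body) (N * (T + 4) + 3) s (P N) := by
  refine Exec.mono (T := 1 + (1 + (N * ((T + (1 + (1 + 1))) + 1) + 1))) ?_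
    (by ring_nf; omega) fun _ h => h
  refine .seq (.instr (.seq (.instr ?_)))
  have := exec_while (x := δ + 1) (N := N) (T := T + (1 + (1 + 1)))
    (body := .seq body <| .seq (.instr (.const (δ + 2) 1)) <| .seq (.instr (.add δ δ (δ + 2))) <|
      .instr (.sub (δ + 1) (δ + 1) (δ + 2)))
    (fun k s => P k s ∧ s.reg δ = k) ?_ N 0
    ((Instr.copy (δ + 1) 0).apply ((Instr.const δ 0).apply s)) (by omega) ⟨?_, ?_⟩ ?_
  · exact this.mono le_rfl fun _ h => h.1
  · rintro k hk s ⟨hP, hs⟩ hx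
    refine .seq ((hbody k hk s hP hs).mono le_rfl ?_)
    rintro s' ⟨hP', h₁, h₂⟩
    refine .seq (.instr (.seq (.instr (.instr ⟨⟨hcongr _ _ _ hP' rfl ?_, ?_⟩, ?_⟩))))
    · intro r hr
      simp [Instr.apply, show r ≠ δ by omega, show r ≠ δ + 1 by omega,
        show r ≠ δ + 2 by omega]
    · simp [Instr.apply, h₁, hs]
    · simp [Instr.apply, h₂, hx]
      omega
  · refine hcongr _ _ _ h0 rfl ?_
    intro r hr
    simp [Instr.apply, show r ≠ δ by omega, show r ≠ δ + 1 by omega]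
  · simp [Instr.apply]
  · simp [Instr.apply, hN, hδ.ne]

/-! #### Compilation of expressions -/

/-- A program that leaves the value of `e` in register `δ`, where the variables are held by the
registers `ρ`. Array `3` holds the multiples of the input length, and array `a + 4` the table `a`
row by row. Only registers from `δ` on are changed. -/
def Expr.compile : Expr → List ℕ → ℕ → Prog
  | .const k, _, δ => .instr (.const δ k)
  | .var i, ρ, δ => match ρ[i]? with
    | some r => .instr (.copy δ r)
    | none => .instr (.const δ 0)
  | .len, _, δ => .instr (.copy δ 0)
  | .input e, ρ, δ => .seq (e.compile ρ δ) (.instr (.load δ 0 δ))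
  | .add e₁ e₂, ρ, δ => .seq (e₁.compile ρ δ) <| .seq (e₂.compile ρ (δ + 1)) <|
      .instr (.add δ δ (δ + 1))
  | .sub e₁ e₂, ρ, δ => .seq (e₁.compile ρ δ) <| .seq (e₂.compile ρ (δ + 1)) <|
      .instr (.sub δ δ (δ + 1))
  | .ite c e₁ e₂, ρ, δ => .seq (c.compile ρ δ) <|
      .ifNonzero δ (e₁.compile ρ δ) (e₂.compile ρ δ)
  | .load a e₁ e₂, ρ, δ => .seq (e₁.compile ρ δ) <| .seq (e₂.compile ρ (δ + 1)) <|
      .seq (.instr (.sub (δ + 2) 0 δ)) <| .seq (.instr (.sub (δ + 3) 0 (δ + 1))) <|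
      .ifNonzero (δ + 2)
        (.ifNonzero (δ + 3)
          (.seq (.instr (.load δ 3 δ)) <| .seq (.instr (.add δ δ (δ + 1))) <|
            .instr (.load δ (a + 4) δ))
          (.instr (.const δ 0)))
        (.instr (.const δ 0))
  | .fold e₀ e, ρ, δ => .seq (e₀.compile ρ δ) <| forProg (δ + 1) <|
      .seq (e.compile (δ :: (δ + 1) :: ρ) (δ + 3)) <| .instr (.copy δ (δ + 3))

/-- A bound on the number of steps for the evaluation of an expression. -/
def Expr.cost (N : ℕ) : Expr → ℕ
  | .const _ => 1
  | .var _ => 1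
  | .len => 1
  | .input e => e.cost N + 1
  | .add e₁ e₂ => e₁.cost N + (e₂.cost N + 1)
  | .sub e₁ e₂ => e₁.cost N + (e₂.cost N + 1)
  | .ite c e₁ e₂ => c.cost N + (e₁.cost N + e₂.cost N + 1)
  | .load _ e₁ e₂ => e₁.cost N + (e₂.cost N + (1 + (1 + (3 + 1 + 1))))
  | .fold e₀ e => e₀.cost N + (N * ((e.cost N + 1) + 4) + 3)

/-- The arrays hold the input word and the tables. -/
structure Represents (w : List ℕ) (σ : Tables) (arr : ℕ → ℕ → ℕ) : Prop where
  input : ∀ i, arr 0 i = w.getD i 0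
  rows : ∀ i < w.length, arr 3 i = i * w.length
  entry : ∀ a, ∀ i < w.length, ∀ j < w.length, arr (a + 4) (i * w.length + j) = σ a i j
  zero : ∀ a i j, ¬ (i < w.length ∧ j < w.length) → σ a i j = 0

/-- The registers `ρ`, all below `δ`, hold the values `env`. -/
def Holds (δ : ℕ) (reg : ℕ → ℕ) (ρ env : List ℕ) : Prop :=
  List.Forall₂ (fun r x => r < δ ∧ reg r = x) ρ env

theorem Holds.congr {δ δ' : ℕ} {reg reg' : ℕ → ℕ} {ρ env : List ℕ} (h : Holds δ reg ρ env)
    (hδ : δ ≤ δ') (hreg : ∀ r < δ, reg' r = reg r) : Holds δ' reg' ρ env :=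
  List.Forall₂.imp (fun r x hr => ⟨hr.1.trans_le hδ, by rw [hreg r hr.1, hr.2]⟩) h

/-- Structural induction, with `δ` acting as a stack pointer: preserving the registers below `δ`
keeps the variables, the input length in register `0` and earlier intermediate results intact while
subexpressions are evaluated. -/
theorem exec_expr {w : List ℕ} {σ : Tables} (e : Expr) : ∀ (ρ env : List ℕ) (δ : ℕ) (s : State),
    0 < δ → s.reg 0 = w.length → Represents w σ s.arr → Holds δ s.reg ρ env →
    Exec (e.compile ρ δ) (e.cost w.length) s fun s' =>
      s'.arr = s.arr ∧ s'.reg δ = e.eval w σ env ∧ ∀ r < δ, s'.reg r = s.reg r := by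
  induction e with
  | const k =>
    intro ρ env δ s hδ hN hM hρ
    refine .instr ⟨rfl, by simp [Instr.apply, Expr.eval], fun r hr => ?_⟩
    simp [Instr.apply, hr.ne]
  | var i =>
    intro ρ env δ s hδ hN hM hρ
    have hl := List.Forall₂.length_eq hρ
    rw [Expr.compile]
    by_cases hi : i < ρ.length
    · have := List.Forall₂.get hρ hi (hl ▸ hi)
      simp only [List.getElem?_eq_getElem hi]
      refine .instr ⟨rfl, ?_, fun r hr => by simp [Instr.apply, hr.ne]⟩
      simp only [List.get_eq_getElem] at this
      simp [Instr.apply, Expr.eval, this.2, List.getElem?_eq_getElem (hl ▸ hi)]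
    · simp only [List.getElem?_eq_none (not_lt.1 hi)]
      refine .instr ⟨rfl, ?_, fun r hr => by simp [Instr.apply, hr.ne]⟩
      simp [Instr.apply, Expr.eval, List.getElem?_eq_none (hl ▸ not_lt.1 hi)]
  | len =>
    intro ρ env δ s hδ hN hM hρ
    refine .instr ⟨rfl, by simp [Instr.apply, Expr.eval, hN], fun r hr => ?_⟩
    simp [Instr.apply, hr.ne]
  | input e ih =>
    intro ρ env δ s hδ hN hM hρ
    refine .seq ((ih ρ env δ s hδ hN hM hρ).mono le_rfl ?_)
    rintro s' ⟨h₁, h₂, h₃⟩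
    refine .instr ⟨h₁, ?_, fun r hr => by simp [Instr.apply, hr.ne, h₃ r hr]⟩
    simp [Instr.apply, Expr.eval, h₁, h₂, hM.input]
  | add e₁ e₂ ih₁ ih₂ =>
    intro ρ env δ s hδ hN hM hρ
    refine .seq ((ih₁ ρ env δ s hδ hN hM hρ).mono le_rfl ?_)
    rintro s' ⟨h₁, h₂, h₃⟩
    refine .seq ((ih₂ ρ env (δ + 1) s' (by omega) (by rw [h₃ 0 hδ, hN]) (h₁ ▸ hM)
      (hρ.congr (by omega) h₃)).mono le_rfl ?_)
    rintro s'' ⟨h₁', h₂', h₃'⟩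
    refine .instr ⟨by simp [Instr.apply, h₁, h₁'], ?_, fun r hr => ?_⟩
    · simp [Instr.apply, Expr.eval, h₂', h₃' δ (by omega), h₂]
    · simp [Instr.apply, hr.ne, h₃' r (by omega), h₃ r hr]
  | sub e₁ e₂ ih₁ ih₂ =>
    intro ρ env δ s hδ hN hM hρ
    refine .seq ((ih₁ ρ env δ s hδ hN hM hρ).mono le_rfl ?_)
    rintro s' ⟨h₁, h₂, h₃⟩
    refine .seq ((ih₂ ρ env (δ + 1) s' (by omega) (by rw [h₃ 0 hδ, hN]) (h₁ ▸ hM)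
      (hρ.congr (by omega) h₃)).mono le_rfl ?_)
    rintro s'' ⟨h₁', h₂', h₃'⟩
    refine .instr ⟨by simp [Instr.apply, h₁, h₁'], ?_, fun r hr => ?_⟩
    · simp [Instr.apply, Expr.eval, h₂', h₃' δ (by omega), h₂]
    · simp [Instr.apply, hr.ne, h₃' r (by omega), h₃ r hr]
  | ite c e₁ e₂ ih ih₁ ih₂ =>
    intro ρ env δ s hδ hN hM hρ
    refine .seq ((ih ρ env δ s hδ hN hM hρ).mono le_rfl ?_)
    rintro s' ⟨h₁, h₂, h₃⟩
    have hρ' := hρ.congr le_rfl h₃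
    have hN' : s'.reg 0 = w.length := by rw [h₃ 0 hδ, hN]
    refine .ite (fun hx => ?_) (fun hx => ?_)
    · refine (ih₁ ρ env δ s' hδ hN' (h₁ ▸ hM) hρ').mono (by omega) ?_
      rintro s'' ⟨h₁', h₂', h₃'⟩
      refine ⟨by rw [h₁', h₁], ?_, fun r hr => by rw [h₃' r hr, h₃ r hr]⟩
      rw [h₂', Expr.eval, if_pos (h₂ ▸ hx)]
    · refine (ih₂ ρ env δ s' hδ hN' (h₁ ▸ hM) hρ').mono (by omega) ?_
      rintro s'' ⟨h₁', h₂', h₃'⟩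
      refine ⟨by rw [h₁', h₁], ?_, fun r hr => by rw [h₃' r hr, h₃ r hr]⟩
      rw [h₂', Expr.eval, if_neg (by simpa [h₂] using hx)]
  | load a e₁ e₂ ih₁ ih₂ =>
    intro ρ env δ s hδ hN hM hρ
    refine .seq ((ih₁ ρ env δ s hδ hN hM hρ).mono le_rfl ?_)
    rintro s' ⟨h₁, h₂, h₃⟩
    refine .seq ((ih₂ ρ env (δ + 1) s' (by omega) (by rw [h₃ 0 hδ, hN]) (h₁ ▸ hM)
      (hρ.congr (by omega) h₃)).mono le_rfl ?_)
    rintro s'' ⟨h₁', h₂', h₃'⟩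
    have hr₁ : s''.reg δ = e₁.eval w σ env := by rw [h₃' δ (by omega), h₂]
    have hr₀ : s''.reg 0 = w.length := by rw [h₃' 0 (by omega), h₃ 0 hδ, hN]
    have harr : s''.arr = s.arr := by rw [h₁', h₁]
    have hreg : ∀ r < δ, s''.reg r = s.reg r := fun r hr => by rw [h₃' r (by omega), h₃ r hr]
    -- The truncated differences of `N` and the indices are nonzero exactly when the indices are in
    -- range. The test is needed because `i * N + j` with `j ≥ N` would address an entry of another
    -- row, whereas tables are zero outside their range.
    refine .seq (.instr (.seq (.instr (.ite (fun hx => .ite (fun hy => ?_) (fun hy => ?_))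
      (fun hx => ?_)))))
    · simp [Instr.apply, hr₁, hr₀, h₂', Nat.sub_eq_zero_iff_le]
        at hx hy
      refine .seq (T₁ := 1) (T₂ := 2) (.instr (.seq (T₁ := 1) (T₂ := 1)
        (.instr (.instr ⟨?_, ?_, fun r hr => ?_⟩))))
      · simp [Instr.apply, harr]
      · simp [Instr.apply, hr₁, h₂', harr, Expr.eval, hM.rows _ hx,
          hM.entry a _ hx _ hy]
      · simp [Instr.apply, hr.ne, hreg r hr, show r ≠ δ + 2 by omega,
          show r ≠ δ + 3 by omega]
    · simp [Instr.apply, hr₁, hr₀, h₂', Nat.sub_eq_zero_iff_le]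
        at hx hy
      refine (Exec.instr ⟨?_, ?_, fun r hr => ?_⟩).mono (by omega) fun _ h => h
      · simp [Instr.apply, harr]
      · simp [Instr.apply, Expr.eval, hM.zero _ _ _ (fun h => absurd h.2 (not_lt.2 hy))]
      · simp [Instr.apply, hr.ne, hreg r hr, show r ≠ δ + 2 by omega,
          show r ≠ δ + 3 by omega]
    · simp [Instr.apply, hr₁, hr₀, Nat.sub_eq_zero_iff_le] at hx
      refine (Exec.instr ⟨?_, ?_, fun r hr => ?_⟩).mono (by omega) fun _ h => h
      · simp [Instr.apply, harr]
      · simp [Instr.apply, Expr.eval, hM.zero _ _ _ (fun h => absurd h.1 (not_lt.2 hx))]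
      · simp [Instr.apply, hr.ne, hreg r hr, show r ≠ δ + 2 by omega,
          show r ≠ δ + 3 by omega]
  | fold e₀ e ih₀ ih =>
    intro ρ env δ s hδ hN hM hρ
    refine .seq ((ih₀ ρ env δ s hδ hN hM hρ).mono le_rfl ?_)
    rintro s' ⟨h₁, h₂, h₃⟩
    refine exec_for (fun k s'' => s''.arr = s.arr ∧
      s''.reg δ = iter (fun k x => e.eval w σ (x :: k :: env)) (e₀.eval w σ env) k ∧
      ∀ r < δ, s''.reg r = s.reg r) (by omega) (by rw [h₃ 0 hδ, hN]) ?_ ⟨h₁, h₂, h₃⟩ ?_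
    · rintro k s₁ s₂ ⟨ha, hb, hc⟩ ha' hr
      exact ⟨ha'.trans ha, (hr δ (by omega)).trans hb,
        fun r hr' => (hr r (by omega)).trans (hc r hr')⟩
    · rintro k hk s₁ ⟨ha, hb, hc⟩ hs₁
      -- The accumulator is register `δ`, the loop index `δ + 1` and the countdown `δ + 2`, so the
      -- body is evaluated from `δ + 3` on.
      refine .seq ((ih (δ :: (δ + 1) :: ρ)
        (iter (fun k x => e.eval w σ (x :: k :: env)) (e₀.eval w σ env) k :: k :: env) (δ + 3) s₁
        (by omega) (by rw [hc 0 hδ, hN]) (ha ▸ hM) ?_).mono le_rfl ?_)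
      · exact .cons ⟨by omega, hb⟩ (.cons ⟨by omega, hs₁⟩ (hρ.congr (by omega) hc))
      · rintro s₂ ⟨ha', hb', hc'⟩
        refine .instr ⟨⟨ha'.trans ha, ?_, fun r hr => ?_⟩, ?_, ?_⟩
        · simp [Instr.apply, hb', iter]
        · simp [Instr.apply, hr.ne, hc' r (by omega), hc r hr]
        · simp [Instr.apply, hc' (δ + 1) (by omega)]
        · simp [Instr.apply, add_assoc, hc' (δ + 2) (by omega)]

end RAM

namespace RAM

/-! #### Compilation of commands -/

/-- Run `body` for all `i, j` below the content of register `0`, held by the registers `δ + 1` and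
`δ + 3`, with register `δ` counting the iterations. -/
def gridProg (δ : ℕ) (body : Prog) : Prog :=
  .seq (.instr (.const δ 0)) <| forProg (δ + 1) <| forProg (δ + 3) <|
    .seq body <| .seq (.instr (.const (δ + 5) 1)) <| .instr (.add δ δ (δ + 5))

/-- The time of a grid with `T` steps for each entry. -/
def gridCost (N T : ℕ) : ℕ := 1 + (N * ((N * ((T + (1 + 1)) + 4) + 3) + 4) + 3)

theorem exec_grid {δ N T : ℕ} {body : Prog} {s : State} (P : ℕ → State → Prop) (hδ : 0 < δ)
    (hN : s.reg 0 = N)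
    (hcongr : ∀ k s s', P k s → s'.arr = s.arr → (∀ r < δ, s'.reg r = s.reg r) → P k s')
    (hP0 : ∀ k s, P k s → s.reg 0 = N) (h0 : P 0 s)
    (hbody : ∀ i < N, ∀ j < N, ∀ s, P (i * N + j) s → s.reg δ = i * N + j → s.reg (δ + 1) = i →
      s.reg (δ + 3) = j → Exec body T s fun s' =>
        P (i * N + j + 1) s' ∧ ∀ r < δ + 5, δ ≤ r → s'.reg r = s.reg r) :
    Exec (gridProg δ body) (gridCost N T) s (P (N * N)) := by
  refine .seq (.instr ?_)
  refine (exec_for (fun i s => P (i * N) s ∧ s.reg δ = i * N) (by omega) ?_ ?_ ⟨?_, ?_⟩ ?_).mono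
    le_rfl fun _ h => h.1
  · simp [Instr.apply, hN, hδ.ne]
  · rintro i s s' ⟨h₁, h₂⟩ ha hr
    exact ⟨hcongr _ _ _ h₁ ha fun r h => hr r (by omega), (hr δ (by omega)).trans h₂⟩
  · rw [Nat.zero_mul]
    exact hcongr _ _ _ h0 rfl fun r h => by simp [Instr.apply, h.ne]
  · simp [Instr.apply]
  · rintro i hi s ⟨h₁, h₂⟩ h₃
    refine (exec_for (fun j s' => P (i * N + j) s' ∧ s'.reg δ = i * N + j ∧
      s'.reg (δ + 1) = i ∧ s'.reg (δ + 2) = s.reg (δ + 2)) (by omega) (hP0 _ _ h₁) ?_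
      ⟨h₁, h₂, h₃, rfl⟩ ?_).mono le_rfl ?_
    · rintro j s s' ⟨h₁, h₂, h₃, h₄⟩ ha hr
      exact ⟨hcongr _ _ _ h₁ ha fun r h => hr r (by omega), (hr δ (by omega)).trans h₂,
        (hr (δ + 1) (by omega)).trans h₃, (hr (δ + 2) (by omega)).trans h₄⟩
    · rintro j hj s' ⟨h₁, h₂, h₃, h₄⟩ h₅
      refine .seq ((hbody i hi j hj s' h₁ h₂ h₃ h₅).mono le_rfl ?_)
      rintro s'' ⟨h₁', h₂'⟩
      refine .seq (.instr (.instr ⟨⟨hcongr _ _ _ h₁' rfl fun r h => ?_, ?_, ?_, ?_⟩, ?_, ?_⟩))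
      · simp [Instr.apply, h.ne, show r ≠ δ + 5 by omega]
      · simp [Instr.apply, h₂' δ, h₂, add_assoc]
      · simp [Instr.apply, h₂' (δ + 1), h₃]
      · simp [Instr.apply, h₂' (δ + 2), h₄]
      · simp [Instr.apply, h₂' (δ + 3)]
      · simp [Instr.apply, add_assoc, h₂' (δ + 4)]
    · rintro s' ⟨h₁', h₂', h₃', hrest⟩
      exact ⟨⟨by rwa [Nat.succ_mul], by rwa [Nat.succ_mul]⟩, h₃'.trans h₃.symm, hrest⟩

/-- A program for a command, where the variables are held by the registers `ρ`. New values of a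
table are first collected in array `2`. Only registers from `δ` on are changed. -/
def Cmd.compile : Cmd → List ℕ → ℕ → Prog
  | .assign a e, ρ, δ => .seq
      (gridProg δ (.seq (e.compile ((δ + 1) :: (δ + 3) :: ρ) (δ + 5))
        (.instr (.store 2 δ (δ + 5)))))
      (gridProg δ (.seq (.instr (.load (δ + 5) 2 δ)) (.instr (.store (a + 4) δ (δ + 5)))))
  | .seq c₁ c₂, ρ, δ => .seq (c₁.compile ρ δ) (c₂.compile ρ δ)
  | .loop c, ρ, δ => forProg δ (c.compile (δ :: ρ) (δ + 2))

/-- A bound on the number of steps of a command. -/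
def Cmd.cost (N : ℕ) : Cmd → ℕ
  | .assign _ e => gridCost N (e.cost N + 1) + gridCost N (1 + 1)
  | .seq c₁ c₂ => c₁.cost N + c₂.cost N
  | .loop c => N * (c.cost N + 4) + 3

theorem mul_add_lt_mul_self {N i j : ℕ} (hi : i < N) (hj : j < N) : i * N + j < N * N :=
  calc i * N + j < i * N + N := by omega
    _ = (i + 1) * N := by ring
    _ ≤ N * N := Nat.mul_le_mul_right _ hi

theorem exec_cmd {w : List ℕ} (c : Cmd) : ∀ (σ : Tables) (ρ env : List ℕ) (δ : ℕ) (s : State),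
    0 < δ → s.reg 0 = w.length → Represents w σ s.arr → Holds δ s.reg ρ env →
    Exec (c.compile ρ δ) (c.cost w.length) s fun s' =>
      Represents w (c.exec w env σ) s'.arr ∧ ∀ r < δ, s'.reg r = s.reg r := by
  induction c with
  | assign a e =>
    intro σ ρ env δ s hδ hN hM hρ
    set N := w.length with hNdef
    -- The value for position `k = i * N + j`, evaluated with the old tables. Array `2` collects all
    -- values before any entry is overwritten, since `e` may read the very table being assigned.
    set val : ℕ → ℕ := fun k => e.eval w σ (k / N :: k % N :: env) with hval
    have hdiv : ∀ i j, j < N → (i * N + j) / N = i ∧ (i * N + j) % N = j := fun i j hj => by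
      have : 0 < N := by omega
      rw [mul_comm]
      exact ⟨by rw [Nat.mul_add_div this, Nat.div_eq_of_lt hj, add_zero],
        by rw [Nat.mul_add_mod, Nat.mod_eq_of_lt hj]⟩
    refine .seq ((exec_grid (fun k s' => (∀ r < δ, s'.reg r = s.reg r) ∧
      (∀ c, c ≠ 2 → s'.arr c = s.arr c) ∧ ∀ k' < k, s'.arr 2 k' = val k') hδ hN ?_ ?_
      ⟨fun _ _ => rfl, fun _ _ => rfl, by simp⟩ ?_).mono le_rfl ?_)
    · rintro k s₁ s₂ ⟨h₁, h₂, h₃⟩ ha hr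
      exact ⟨fun r h => (hr r h).trans (h₁ r h), by rwa [ha], by rwa [ha]⟩
    · rintro k s₁ ⟨h₁, -, -⟩
      rw [h₁ 0 hδ, hN]
    · rintro i hi j hj s₁ ⟨h₁, h₂, h₃⟩ hk hi' hj'
      refine .seq ((exec_expr (w := w) (σ := σ) e _ (i :: j :: env) (δ + 5) s₁ (by omega)
        (by rw [h₁ 0 hδ, hN]) ?_ ?_).mono le_rfl ?_)
      · exact ⟨fun i => by rw [h₂ 0 (by omega), hM.input],
          fun i h => by rw [h₂ 3 (by omega), hM.rows i h],
          fun a i hi j hj => by rw [h₂ _ (by omega), hM.entry a i hi j hj], hM.zero⟩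
      · exact .cons ⟨by omega, hi'⟩ (.cons ⟨by omega, hj'⟩ (hρ.congr (by omega) h₁))
      · rintro s₂ ⟨ha, hb, hc⟩
        refine .instr ⟨⟨fun r h => ?_, fun c hc' => ?_, fun k' hk' => ?_⟩, fun r h _ => ?_⟩
        · simp [Instr.apply, hc r (by omega), h₁ r h]
        · simp [Instr.apply, hc', ha, h₂ c hc']
        · obtain h | h := Nat.lt_succ_iff_lt_or_eq.1 hk'
          · simp [Instr.apply, hc δ (by omega), hk, h.ne, ha, h₃ k' h]
          · simp [Instr.apply, hc δ (by omega), hk, hb, h, hval, hdiv i j hj]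
        · simp [Instr.apply, hc r (by omega)]
    · rintro s₁ ⟨h₁, h₂, h₃⟩
      refine (exec_grid (fun k s' => (∀ r < δ, s'.reg r = s.reg r) ∧
        (∀ c, c ≠ a + 4 → s'.arr c = s₁.arr c) ∧ ∀ k' < k, s'.arr (a + 4) k' = val k')
        hδ (by rw [h₁ 0 hδ, hN]) ?_ ?_ ⟨h₁, fun _ _ => rfl, by simp⟩ ?_).mono le_rfl ?_
      · rintro k s₁ s₂ ⟨h₁, h₂, h₃⟩ ha hr
        exact ⟨fun r h => (hr r h).trans (h₁ r h), by rwa [ha], by rwa [ha]⟩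
      · rintro k s₁ ⟨h₁, -, -⟩
        rw [h₁ 0 hδ, hN]
      · rintro i hi j hj s₂ ⟨h₁', h₂', h₃'⟩ hk hi' hj'
        refine .seq (.instr (.instr ⟨⟨fun r h => ?_, fun c hc' => ?_, fun k' hk' => ?_⟩,
          fun r h _ => ?_⟩))
        · simp [Instr.apply, h₁' r h, show r ≠ δ + 5 by omega]
        · simp [Instr.apply, hc', h₂' c hc']
        · obtain h | h := Nat.lt_succ_iff_lt_or_eq.1 hk'
          · simp [Instr.apply, hk, h.ne, h₃' k' h]
          · simp [Instr.apply, hk, h, h₂' 2 (by omega),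
              h₃ _ (mul_add_lt_mul_self hi hj)]
        · simp [Instr.apply, h.ne]
      · rintro s₂ ⟨h₁', h₂', h₃'⟩
        refine ⟨⟨fun i => ?_, fun i hi => ?_, fun b i hi j hj => ?_, fun b i j hij => ?_⟩, h₁'⟩
        · rw [h₂' 0 (by omega), h₂ 0 (by omega), hM.input]
        · rw [h₂' 3 (by omega), h₂ 3 (by omega), hM.rows i hi]
        · by_cases hb : b = a
          · subst hb
            rw [h₃' _ (mul_add_lt_mul_self hi hj)]
            simp [Cmd.exec, hval, hdiv i j hj, mkTable, ← hNdef, show i < N from hi,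
              show j < N from hj]
          · rw [h₂' _ (by omega), h₂ _ (by omega), hM.entry b i hi j hj]
            simp [Cmd.exec, hb]
        · by_cases hb : b = a
          · subst hb
            simp only [Cmd.exec, Function.update_self, mkTable, if_neg hij]
          · simpa [Cmd.exec, hb] using hM.zero b i j hij
  | seq c₁ c₂ ih₁ ih₂ =>
    intro σ ρ env δ s hδ hN hM hρ
    refine .seq ((ih₁ σ ρ env δ s hδ hN hM hρ).mono le_rfl ?_)
    rintro s' ⟨h₁, h₂⟩
    refine (ih₂ _ ρ env δ s' hδ (by rw [h₂ 0 hδ, hN]) h₁ (hρ.congr le_rfl h₂)).mono le_rfl ?_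
    rintro s'' ⟨h₁', h₂'⟩
    exact ⟨h₁', fun r hr => by rw [h₂' r hr, h₂ r hr]⟩
  | loop c ih =>
    intro σ ρ env δ s hδ hN hM hρ
    refine exec_for (fun k s' =>
      Represents w (iter (fun k σ => c.exec w (k :: env) σ) σ k) s'.arr ∧
      ∀ r < δ, s'.reg r = s.reg r) hδ hN ?_ ⟨hM, fun _ _ => rfl⟩ ?_
    · rintro k s₁ s₂ ⟨ha, hb⟩ ha' hr
      exact ⟨by rwa [ha'], fun r h => (hr r h).trans (hb r h)⟩
    · rintro k hk s₁ ⟨ha, hb⟩ hs₁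
      refine (ih _ (δ :: ρ) (k :: env) (δ + 2) s₁ (by omega) (by rw [hb 0 hδ, hN]) ha
        (.cons ⟨by omega, hs₁⟩ (hρ.congr (by omega) hb))).mono le_rfl ?_
      rintro s₂ ⟨ha', hb'⟩
      exact ⟨⟨ha', fun r hr => (hb' r (by omega)).trans (hb r hr)⟩, hb' _ (by omega),
        hb' _ (by omega)⟩

/-! #### Polynomial bounds -/

/-- A function bounded by a polynomial. -/
def PolyBounded (f : ℕ → ℕ) : Prop := ∃ P : Polynomial ℕ, ∀ N, f N ≤ P.eval N

theorem PolyBounded.const (k : ℕ) : PolyBounded fun _ => k := ⟨.C k, fun N => by simp⟩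

theorem PolyBounded.id : PolyBounded fun N => N := ⟨.X, fun N => by simp⟩

theorem PolyBounded.add {f g : ℕ → ℕ} (hf : PolyBounded f) (hg : PolyBounded g) :
    PolyBounded fun N => f N + g N := by
  obtain ⟨P, hP⟩ := hf
  obtain ⟨Q, hQ⟩ := hg
  exact ⟨P + Q, fun N => by simpa using add_le_add (hP N) (hQ N)⟩

theorem PolyBounded.mul {f g : ℕ → ℕ} (hf : PolyBounded f) (hg : PolyBounded g) :
    PolyBounded fun N => f N * g N := by
  obtain ⟨P, hP⟩ := hf
  obtain ⟨Q, hQ⟩ := hg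
  exact ⟨P * Q, fun N => by simpa using Nat.mul_le_mul (hP N) (hQ N)⟩

theorem PolyBounded.loop {f : ℕ → ℕ} (hf : PolyBounded f) :
    PolyBounded fun N => N * (f N + 4) + 3 :=
  (id.mul (hf.add (.const 4))).add (.const 3)

theorem PolyBounded.gridCost {f : ℕ → ℕ} (hf : PolyBounded f) :
    PolyBounded fun N => gridCost N (f N) :=
  (const 1).add (hf.add (.const 2)).loop.loop

theorem Expr.polyBounded_cost (e : Expr) : PolyBounded fun N => e.cost N := by
  induction e with
  | const | var | len => exact .const 1
  | input e ih => exact ih.add (.const 1)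
  | add e₁ e₂ ih₁ ih₂ => exact ih₁.add (ih₂.add (.const 1))
  | sub e₁ e₂ ih₁ ih₂ => exact ih₁.add (ih₂.add (.const 1))
  | ite c e₁ e₂ ih ih₁ ih₂ => exact ih.add ((ih₁.add ih₂).add (.const 1))
  | load a e₁ e₂ ih₁ ih₂ => exact ih₁.add (ih₂.add (.const _))
  | fold e₀ e ih₀ ih => exact ih₀.add (ih.add (.const 1)).loop

theorem Cmd.polyBounded_cost (c : Cmd) : PolyBounded fun N => c.cost N := by
  induction c with
  | assign a e =>
    exact (e.polyBounded_cost.add (.const 1)).gridCost.add (PolyBounded.const _).gridCost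
  | seq c₁ c₂ ih₁ ih₂ => exact ih₁.add ih₂
  | loop c ih => exact ih.loop

theorem eval_polynomial_mono (P : Polynomial ℕ) : Monotone fun N => P.eval N := by
  intro a b hab
  induction P using Polynomial.induction_on' with
  | add p q hp hq => simpa using add_le_add hp hq
  | monomial k c => simpa using Nat.mul_le_mul_left c (Nat.pow_le_pow_left hab k)

theorem length_le_size (w : List ℕ) : w.length ≤ size w := by
  induction w with
  | nil => simp
  | cons a w ih =>
    simp only [size, List.map_cons, List.sum_cons, List.length_cons] at ih ⊢
    omega

/-! #### Complete programs -/

/-- Prepare the array of multiples of the input length, run `c`, then output the first entries of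
the rows of table `a`, their number being given by `e`. -/
def Cmd.program (c : Cmd) (a : ℕ) (e : Expr) : Prog :=
  .seq (forProg 2 (.seq (.instr (.store 3 2 1)) (.instr (.add 1 1 0)))) <|
  .seq (c.compile [] 1) <|
  .seq (forProg 1 (.seq ((Expr.load a (.var 0) (.const 0)).compile [1] 3)
    (.instr (.store 1 1 3)))) <|
  .seq (e.compile [] 1) (.instr (.copy 0 1))

theorem exec_program (w : List ℕ) (c : Cmd) (a : ℕ) (e : Expr)
    (he : e.eval w (c.exec w [] 0) [] ≤ w.length) :
    Exec (c.program a e)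
      ((w.length * ((1 + 1) + 4) + 3) + (c.cost w.length + ((w.length *
        (((Expr.load a (.var 0) (.const 0)).cost w.length + 1) + 4) + 3) +
          (e.cost w.length + 1)))) (init w)
      fun s => Outputs s
        ((List.range (e.eval w (c.exec w [] 0) [])).map fun i => c.exec w [] 0 a i 0) := by
  set N := w.length with hN
  -- Without multiplication the row offsets `k * N` arise by repeated addition in register `1`.
  refine .seq ((exec_for (fun k s => s.reg 0 = N ∧ s.reg 1 = k * N ∧
    (∀ c, c ≠ 3 → s.arr c = (init w).arr c) ∧ ∀ i < k, s.arr 3 i = i * N) (by omega) ?_ ?_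
    ⟨?_, ?_, fun _ _ => rfl, by simp⟩ ?_).mono le_rfl ?_)
  · simp [RAM.init, hN]
  · rintro k s s' ⟨h₁, h₂, h₃, h₄⟩ ha hr
    exact ⟨(hr 0 (by omega)).trans h₁, (hr 1 (by omega)).trans h₂, by rwa [ha], by rwa [ha]⟩
  · simp [RAM.init, hN]
  · simp [RAM.init]
  · rintro k hk s ⟨h₁, h₂, h₃, h₄⟩ h₅
    refine .seq (.instr (.instr ⟨⟨?_, ?_, fun c hc => ?_, fun i hi => ?_⟩, ?_, ?_⟩))
    · simp [Instr.apply, h₁]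
    · simp [Instr.apply, h₁, h₂, Nat.succ_mul]
    · simp [Instr.apply, hc, h₃ c hc]
    · obtain h | h := Nat.lt_succ_iff_lt_or_eq.1 hi
      · simp [Instr.apply, h₅, h.ne, h₄ i h]
      · simp [Instr.apply, h₅, h₂, h]
    · simp [Instr.apply]
    · simp [Instr.apply]
  rintro s ⟨h₁, -, h₃, h₄⟩
  have hM : Represents w 0 s.arr := by
    refine ⟨fun i => ?_, h₄, fun b i _ j _ => ?_, fun _ _ _ _ => rfl⟩
    · rw [h₃ 0 (by omega)]
      simp [RAM.init]
    · rw [h₃ _ (by omega)]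
      simp [RAM.init]
  refine .seq ((exec_cmd c 0 [] [] 1 s one_pos h₁ hM .nil).mono le_rfl ?_)
  rintro s₁ ⟨hM₁, hr₁⟩
  set σ := c.exec w [] 0 with hσ
  have hs₁ : s₁.reg 0 = N := by rw [hr₁ 0 one_pos, h₁]
  refine .seq ((exec_for (fun k s => s.reg 0 = N ∧ (∀ c, c ≠ 1 → s.arr c = s₁.arr c) ∧
    ∀ i < k, s.arr 1 i = σ a i 0) one_pos hs₁ ?_ ⟨hs₁, fun _ _ => rfl, by simp⟩ ?_).mono
    le_rfl ?_)
  · rintro k s s' ⟨h₁, h₂, h₃⟩ ha hr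
    exact ⟨(hr 0 one_pos).trans h₁, by rwa [ha], by rwa [ha]⟩
  · rintro k hk s ⟨h₁, h₂, h₃⟩ h₄
    refine .seq ((exec_expr (w := w) (σ := σ) _ [1] [k] 3 s (by omega) h₁ ?_ ?_).mono le_rfl ?_)
    · exact ⟨fun i => by rw [h₂ 0 (by omega), hM₁.input],
        fun i h => by rw [h₂ 3 (by omega), hM₁.rows i h],
        fun a i hi j hj => by rw [h₂ _ (by omega), hM₁.entry a i hi j hj], hM₁.zero⟩
    · exact .cons ⟨by omega, h₄⟩ .nil
    · rintro s' ⟨ha, hb, hc⟩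
      refine .instr ⟨⟨?_, fun c hc' => ?_, fun i hi => ?_⟩, ?_, ?_⟩
      · simp [Instr.apply, hc 0, h₁]
      · simp [Instr.apply, hc', ha, h₂ c hc']
      · obtain h | h := Nat.lt_succ_iff_lt_or_eq.1 hi
        · simp [Instr.apply, hc 1, h₄, h.ne, ha, h₃ i h]
        · simp [Instr.apply, hc 1, h₄, h, hb, Expr.eval]
      · simp [Instr.apply, hc 1]
      · simp [Instr.apply, hc 2]
  rintro s₂ ⟨h₁, h₂, h₃⟩
  refine .seq ((exec_expr (w := w) (σ := σ) e [] [] 1 s₂ one_pos h₁ ?_ .nil).mono le_rfl ?_)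
  · exact ⟨fun i => by rw [h₂ 0 (by omega), hM₁.input],
      fun i h => by rw [h₂ 3 (by omega), hM₁.rows i h],
      fun a i hi j hj => by rw [h₂ _ (by omega), hM₁.entry a i hi j hj], hM₁.zero⟩
  · rintro s' ⟨ha, hb, hc⟩
    refine .instr ⟨by simp [Instr.apply, hb], fun i hi => ?_⟩
    simp only [List.length_map, List.length_range] at hi
    simp [Instr.apply, ha, h₃ i (hi.trans_le he)]

/-- A problem is solvable in polynomial time if a command on tables computes solutions. -/
theorem polyTimeSolvable_of_cmd {α : Type} {enc : α → List ℕ} {Sol : α → List ℕ → Prop}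
    (c : Cmd) (a : ℕ) (e : Expr)
    (he : ∀ x, e.eval (enc x) (c.exec (enc x) [] 0) [] ≤ (enc x).length)
    (h : ∀ x, Sol x ((List.range (e.eval (enc x) (c.exec (enc x) [] 0) [])).map
      fun i => c.exec (enc x) [] 0 a i 0)) : PolyTimeSolvable enc Sol := by
  obtain ⟨P, hP⟩ := (PolyBounded.const (1 + 1)).loop.add (c.polyBounded_cost.add
    (((Expr.load a (.var 0) (.const 0)).polyBounded_cost.add (.const 1)).loop.add
      (e.polyBounded_cost.add (.const 1))))
  refine ⟨c.program a e, P, fun x => ?_⟩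
  obtain ⟨s, t, hr, ht, ho⟩ := exec_program (enc x) c a e (he x)
  exact ⟨s, t, _, hr, ht.trans ((hP _).trans (eval_polynomial_mono P (length_le_size _))), ho, h x⟩

end RAM

/-! ### Elimination in the order of decreasing weight -/

/-- The state of an elimination process that has treated the coordinates in `Δ`: the rows span the
vectors of `B` that vanish on `Δ`, and `z`, an element of the coset `z₀ + B`, has the least possible
support in `Δ` with respect to the weight `W`. -/
structure EliminationState (B : Submodule (ZMod 2) (ℕ → ZMod 2)) (z₀ : ℕ → ZMod 2) (W : ℕ → ℕ)
    (rows : ℕ → ℕ → ZMod 2) (z : ℕ → ZMod 2) (Δ : Set ℕ) : Prop where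
  mem_span : ∀ y, y ∈ Submodule.span (ZMod 2) (Set.range rows) ↔ y ∈ B ∧ ∀ s ∈ Δ, y s = 0
  coset : z - z₀ ∈ B
  opt : ∀ y ∈ B, (∃ s ∈ Δ, y s ≠ 0) → ∃ s ∈ Δ, y s ≠ 0 ∧ z s = 0 ∧ ∀ r, y r ≠ 0 → W r ≤ W s

namespace EliminationState

variable {B : Submodule (ZMod 2) (ℕ → ZMod 2)} {z₀ : ℕ → ZMod 2} {W : ℕ → ℕ}
  {rows : ℕ → ℕ → ZMod 2} {z : ℕ → ZMod 2} {Δ : Set ℕ}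

theorem initial (hB : Submodule.span (ZMod 2) (Set.range rows) = B) :
    EliminationState B z W rows z ∅ where
  mem_span y := by simp [hB]
  coset := by simp
  opt := by simp

/-- By `ht` the row `t` is nonzero at `s` unless the whole column `s` vanishes, in which case
nothing changes. By `hs` the coordinate `s` is at least as heavy as any untreated coordinate that
occurs in `B`. -/
theorem step (h : EliminationState B z₀ W rows z Δ) {s t : ℕ}
    (hs : ∀ r ∉ Δ, (∃ y ∈ B, y r ≠ 0) → W r ≤ W s)
    (ht : ∀ τ, rows τ s ≠ 0 → rows t s ≠ 0) :
    EliminationState B z₀ W (fun τ => rows τ + rows τ s • rows t)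
      (z + (z s * rows t s) • rows t) (insert s Δ) := by
  have two : ∀ a b : ZMod 2, (a ≠ 0 → b ≠ 0) → a + a * b = 0 := by decide
  have hrow : ∀ τ, rows τ ∈ Submodule.span (ZMod 2) (Set.range rows) :=
    fun τ => Submodule.subset_span ⟨τ, rfl⟩
  have htB := (h.mem_span _).1 (hrow t)
  refine ⟨fun y => ⟨fun hy => ?_, fun hy => ?_⟩, ?_, ?_⟩
  -- A new row is a combination of old rows, and it vanishes at `s`: a row that is nonzero there has
  -- the pivot row, also nonzero there, added to it.
  · have hle : y ∈ Submodule.span (ZMod 2) (Set.range rows) ∧ y s = 0 := by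
      induction hy using Submodule.span_induction with
      | mem x hx =>
        obtain ⟨τ, rfl⟩ := hx
        exact ⟨add_mem (hrow τ) (Submodule.smul_mem _ _ (hrow t)), two _ _ (ht τ)⟩
      | zero => exact ⟨zero_mem _, rfl⟩
      | add x y _ _ hx hy => exact ⟨add_mem hx.1 hy.1, by simp [hx.2, hy.2]⟩
      | smul a x _ hx => exact ⟨Submodule.smul_mem _ _ hx.1, by simp [hx.2]⟩
    have := (h.mem_span y).1 hle.1
    exact ⟨this.1, Set.forall_mem_insert.2 ⟨hle.2, this.2⟩⟩
  · obtain ⟨hyB, hy⟩ := hy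
    rw [Set.forall_mem_insert] at hy
    -- The map `y ↦ y + y s • rows t` is linear and sends old rows to new rows. It fixes the vectors
    -- with `y s = 0`, so these stay in the span.
    have key : ∀ y ∈ Submodule.span (ZMod 2) (Set.range rows), y + y s • rows t ∈
        Submodule.span (ZMod 2) (Set.range fun τ => rows τ + rows τ s • rows t) := by
      intro y hy
      induction hy using Submodule.span_induction with
      | mem x hx =>
        obtain ⟨τ, rfl⟩ := hx
        exact Submodule.subset_span ⟨τ, rfl⟩
      | zero => simp
      | add x y _ _ hx hy =>
        convert add_mem hx hy using 1
        rw [Pi.add_apply, add_smul]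
        abel
      | smul a x _ hx =>
        convert Submodule.smul_mem _ a hx using 1
        rw [Pi.smul_apply, smul_add, smul_eq_mul, mul_smul]
    simpa [hy.1] using key y ((h.mem_span y).2 ⟨hyB, hy.2⟩)
  · rw [add_sub_right_comm]
    exact add_mem h.coset (B.smul_mem _ htB.1)
  · intro y hyB hy
    by_cases hyΔ : ∃ r ∈ Δ, y r ≠ 0
    -- The old witness survives: the pivot row vanishes on `Δ`, so `z` is unchanged there.
    · obtain ⟨r, hr, h₁, h₂, h₃⟩ := h.opt y hyB hyΔ
      exact ⟨r, Set.mem_insert_of_mem _ hr, h₁, by simp [h₂, htB.2 r hr], h₃⟩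
    · push Not at hyΔ
      obtain ⟨r, hr, hyr⟩ := hy
      obtain rfl | hr := Set.mem_insert_iff.1 hr
      · refine ⟨r, Set.mem_insert _ _, hyr, ?_, fun x hx => ?_⟩
        -- Here `r` is the pivot column. If the pivot row vanished there, so would all rows by `ht`,
        -- and with them `y`, which lies in their span because it vanishes on `Δ`.
        · have hex : rows t r ≠ 0 := by
            by_contra h0
            have hall : ∀ τ, rows τ r = 0 := fun τ => by
              by_contra h'
              exact ht τ h' h0
            have hy' := (h.mem_span y).2 ⟨hyB, hyΔ⟩
            refine hyr ?_
            clear hyr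
            induction hy' using Submodule.span_induction with
            | mem x hx =>
              obtain ⟨τ, rfl⟩ := hx
              exact hall τ
            | zero => rfl
            | add x y hx' hy' hx hy =>
              have hx' := (h.mem_span x).1 hx'
              have hy' := (h.mem_span y).1 hy'
              simp [hx hx'.1 hx'.2, hy hy'.1 hy'.2]
            | smul a x hx' hx =>
              have hx' := (h.mem_span x).1 hx'
              simp [hx hx'.1 hx'.2]
          have three : ∀ a b : ZMod 2, b ≠ 0 → a + a * b * b = 0 := by decide
          exact three _ _ hex
        · exact hs x (fun hxΔ => hx (hyΔ x hxΔ)) ⟨y, hyB, hx⟩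
      · exact absurd (hyΔ r hr) hyr

theorem final (h : EliminationState B z₀ W rows z Δ)
    (hΔ : ∀ y ∈ B, ∀ r, y r ≠ 0 → r ∈ Δ) {z' : ℕ → ZMod 2} (hz' : z' - z₀ ∈ B) {r : ℕ}
    (hr : z r ≠ 0) : ∃ s, z' s ≠ 0 ∧ W r ≤ W s := by
  by_cases hzr : z' r = 0
  · have hy : z' - z ∈ B := by
      rw [← sub_sub_sub_cancel_right z' z z₀]
      exact sub_mem hz' h.coset
    have hyr : (z' - z) r ≠ 0 := by simpa [hzr] using hr
    obtain ⟨s, -, h₁, h₂, h₃⟩ := h.opt _ hy ⟨r, hΔ _ hy r hyr, hyr⟩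
    exact ⟨s, by simpa [h₂] using h₁, h₃ r hyr⟩
  · exact ⟨r, hzr, le_rfl⟩

end EliminationState

namespace CycleLocalization

/-! ### The boundary of a boundary -/

section Boundary

variable {n : ℕ} {K : AbstractSimplicialComplex (Fin n)}

/-- If `ρ ⊆ τ`, exactly two simplices lie in between, one for each element of `τ \ ρ`; they are
faces because `K` is closed under nonempty subsets. -/
theorem sum_intermediate_simplices {d : ℕ} (ρ : Simplex K d) (τ : Simplex K (d + 2)) :
    (∑ σ : Simplex K (d + 1), if ρ.1 ⊆ σ.1 then (if σ.1 ⊆ τ.1 then (1 : ZMod 2) else 0) else 0)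
      = 0 := by
  by_cases hρτ : ρ.1 ⊆ τ.1
  swap
  · refine Finset.sum_eq_zero fun σ _ => ?_
    split_ifs with h₁ h₂
    · exact absurd (h₁.trans h₂) hρτ
    · rfl
    · rfl
  have hcard : (τ.1 \ ρ.1).card = 2 := by
    rw [Finset.card_sdiff_of_subset hρτ, τ.2.2, ρ.2.2]
    omega
  have hmem : ∀ x ∈ τ.1 \ ρ.1, insert x ρ.1 ∈ K.faces ∧ (insert x ρ.1).card = d + 1 := by
    intro x hx
    rw [Finset.mem_sdiff] at hx
    exact ⟨(K.isRelLowerSet_faces τ.2.1).2 (Finset.insert_subset hx.1 hρτ)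
      (Finset.insert_nonempty _ _), by rw [Finset.card_insert_of_notMem hx.2, ρ.2.2]⟩
  have hsum : (∑ _x : {x // x ∈ τ.1 \ ρ.1}, (1 : ZMod 2)) = 0 := by
    simp only [Finset.sum_const, Finset.card_univ, Fintype.card_coe, hcard]
    rfl
  refine Eq.trans ?_ hsum
  simp only [← ite_and]
  rw [← Finset.sum_filter]
  symm
  refine Finset.sum_bij (fun x _ => ⟨insert x.1 ρ.1, hmem x.1 x.2⟩) ?_ ?_ ?_ ?_
  · intro x _
    have hx := (Finset.mem_sdiff.1 x.2).1
    simp [Finset.insert_subset hx hρτ]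
  · intro x _ y _ hxy
    have hxy := congrArg Subtype.val hxy
    have hx := (Finset.mem_sdiff.1 x.2).2
    have : x.1 ∈ insert y.1 ρ.1 := by
      rw [← show insert x.1 ρ.1 = insert y.1 ρ.1 from hxy]
      exact Finset.mem_insert_self _ _
    exact Subtype.ext ((Finset.mem_insert.1 this).resolve_right hx)
  · intro σ hσ
    obtain ⟨h₁, h₂⟩ := (Finset.mem_filter.1 hσ).2
    have h₃ : ((σ.1 \ ρ.1).card) = 1 := by
      rw [Finset.card_sdiff_of_subset h₁, σ.2.2, ρ.2.2]
      omega
    obtain ⟨x, hx⟩ := Finset.card_eq_one.1 h₃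
    have hxm : x ∈ σ.1 \ ρ.1 := by simp [hx]
    refine ⟨⟨x, Finset.sdiff_subset_sdiff h₂ le_rfl hxm⟩, Finset.mem_univ _, Subtype.ext ?_⟩
    change insert x ρ.1 = σ.1
    rw [Finset.insert_eq, ← hx, Finset.sdiff_union_of_subset h₁]
  · intro _ _
    rfl

theorem boundary_boundary (d : ℕ) (c : Chain K (d + 2)) :
    boundary K d (boundary K (d + 1) c) = 0 := by
  funext ρ
  change (∑ σ : Simplex K (d + 1), if ρ.1 ⊆ σ.1 then
    (∑ τ : Simplex K (d + 2), if σ.1 ⊆ τ.1 then c τ else 0) else 0) = 0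
  have : ∀ σ : Simplex K (d + 1), (if ρ.1 ⊆ σ.1 then
      (∑ τ : Simplex K (d + 2), if σ.1 ⊆ τ.1 then c τ else 0) else 0) =
      ∑ τ : Simplex K (d + 2),
        (if ρ.1 ⊆ σ.1 then (if σ.1 ⊆ τ.1 then (1 : ZMod 2) else 0) else 0) * c τ := by
    intro σ
    split_ifs <;> simp
  rw [Finset.sum_congr rfl fun σ _ => this σ, Finset.sum_comm]
  refine Finset.sum_eq_zero fun τ _ => ?_
  rw [← Finset.sum_mul, sum_intermediate_simplices, zero_mul]

theorem boundary_single {d : ℕ} (τ : Simplex K (d + 2)) (σ : Simplex K (d + 1)) :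
    boundary K (d + 1) (Pi.single τ 1) σ = if σ.1 ⊆ τ.1 then 1 else 0 := by
  classical
  change (∑ τ' : Simplex K (d + 2), if σ.1 ⊆ τ'.1 then (Pi.single τ 1 : Chain K (d + 2)) τ' else 0)
    = _
  rw [Finset.sum_eq_single τ]
  · simp
  · intro τ' _ h
    simp [h]
  · simp

theorem span_boundary_single (d : ℕ) :
    Submodule.span (ZMod 2) (Set.range fun τ : Simplex K (d + 2) =>
      boundary K (d + 1) (Pi.single τ 1)) = Boundaries K d := by
  classical
  rw [Boundaries, LinearMap.range_eq_map, ← (Pi.basisFun (ZMod 2) (Simplex K (d + 2))).span_eq,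
    Submodule.map_span, ← Set.range_comp]
  congr 2
  funext τ
  simp

end Boundary

/-! ### Shortest paths by relaxation -/

section Distance

variable {n : ℕ} {K : AbstractSimplicialComplex (Fin n)} {len : Simplex K 2 → ℕ}

theorem pathLength_cons {u v q : Fin n} (h : (oneSkeleton K).Adj u v)
    (w : (oneSkeleton K).Walk v q) :
    pathLength len (.cons h w) = len (edgeOfDart ⟨(u, v), h⟩) + pathLength len w := by
  simp [pathLength]

theorem pathLength_bypass_le {p q : Fin n} (w : (oneSkeleton K).Walk p q) :
    pathLength len w.bypass ≤ pathLength len w :=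
  (w.darts_bypass_sublist_darts.map _).sum_le_sum (by simp)

theorem edgeOfDart_symm (e : (oneSkeleton K).Dart) : edgeOfDart e.symm = edgeOfDart e :=
  Subtype.ext (Finset.pair_comm _ _)

theorem pathLength_reverse {p q : Fin n} (w : (oneSkeleton K).Walk p q) :
    pathLength len w.reverse = pathLength len w := by
  simp only [pathLength, SimpleGraph.Walk.darts_reverse, List.map_map, List.map_reverse,
    List.sum_reverse]
  congr 2
  funext e
  simp [edgeOfDart_symm]

theorem pathLength_le_mul {S : ℕ} (hS : ∀ e, len e ≤ S) {p q : Fin n}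
    (w : (oneSkeleton K).Walk p q) : pathLength len w ≤ w.length * S := by
  induction w with
  | nil => simp [pathLength]
  | cons h w ih =>
    rw [pathLength_cons, SimpleGraph.Walk.length_cons, Nat.succ_mul, add_comm]
    exact add_le_add ih (hS _)

/-- `D k` are the distance estimates from `p` after `k` rounds of relaxation, with edge lengths `L`
and with values from `top` on for missing edges. -/
structure Relaxation (len : Simplex K 2 → ℕ) (N top : ℕ) (L : ℕ → ℕ → ℕ) (p : Fin n)
    (D : ℕ → ℕ → ℕ) : Prop where
  le : n ≤ N
  adj : ∀ (u v : Fin n) (h : (oneSkeleton K).Adj u v), L u v = len (edgeOfDart ⟨(u, v), h⟩)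
  adj_of_lt : ∀ u < N, ∀ v < N, L u v < top →
    ∃ u' v' : Fin n, u' = u ∧ v' = v ∧ (oneSkeleton K).Adj u' v'
  zero : ∀ v < N, D 0 v = if v = p then 0 else top
  le_self : ∀ k < N, ∀ v < N, D (k + 1) v ≤ D k v
  le_add : ∀ k < N, ∀ v < N, ∀ u < N, D (k + 1) v ≤ D k u + L u v
  eq : ∀ k < N, ∀ v < N, D (k + 1) v = D k v ∨ ∃ u < N, D (k + 1) v = D k u + L u v

namespace Relaxation

variable {N top : ℕ} {L : ℕ → ℕ → ℕ} {p : Fin n} {D : ℕ → ℕ → ℕ}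

/-- An estimate below `top` can have used no missing edge, so unfolding the minima produces a walk
of that length. -/
theorem exists_walk (h : Relaxation len N top L p D) : ∀ k ≤ N, ∀ v < N, D k v < top →
    ∃ v' : Fin n, v' = v ∧ ∃ w : (oneSkeleton K).Walk v' p, pathLength len w = D k v := by
  intro k
  induction k with
  | zero =>
    intro _ v hv hD
    rw [h.zero v hv] at hD ⊢
    split_ifs at hD ⊢ with hvp
    · exact ⟨p, hvp.symm, .nil, by simp [pathLength]⟩
    · omega
  | succ k ih =>
    intro hk v hv hD
    obtain heq | ⟨u, hu, heq⟩ := h.eq k hk v hv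
    · rw [heq] at hD ⊢
      exact ih (by omega) v hv hD
    · obtain ⟨u', hu', w, hw⟩ := ih (by omega) u hu (by omega)
      obtain ⟨u'', v', hu'', hv', hadj⟩ := h.adj_of_lt u hu v hv (by omega)
      obtain rfl : u' = u'' := Fin.ext (hu'.trans hu''.symm)
      refine ⟨v', hv', .cons hadj.symm w, ?_⟩
      rw [pathLength_cons, hw, heq, ← hu', ← hv', h.adj u' v' hadj, add_comm,
        ← edgeOfDart_symm]
      rfl

/-- After `k` rounds all walks with at most `k` edges have been taken into account. Walks end at
`p`, so that removing their first edge matches one round. -/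
theorem le_pathLength (h : Relaxation len N top L p D) : ∀ k ≤ N, ∀ (v : Fin n)
    (w : (oneSkeleton K).Walk v p), w.length ≤ k → D k v ≤ pathLength len w := by
  intro k
  induction k with
  | zero =>
    intro _ v w hw
    obtain rfl := SimpleGraph.Walk.eq_of_length_eq_zero (Nat.le_zero.1 hw)
    rw [h.zero _ ((Fin.is_lt _).trans_le h.le), if_pos rfl]
    exact Nat.zero_le _
  | succ k ih =>
    intro hk v w hw
    have hv := v.2.trans_le h.le
    cases w with
    | nil => exact (h.le_self k hk _ hv).trans (ih (by omega) _ .nil (by simp))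
    | @cons _ u _ hadj w =>
      rw [SimpleGraph.Walk.length_cons] at hw
      refine (h.le_add k hk v hv u (u.2.trans_le h.le)).trans ?_
      rw [pathLength_cons, h.adj u v hadj.symm, add_comm, ← edgeOfDart_symm]
      exact add_le_add_right (ih (by omega) u w (by omega)) _

theorem geodist_le (h : Relaxation len N top L p D) {q : Fin n} (hq : D N q < top) :
    geodist len p q ≤ D N q := by
  obtain ⟨q', hq', w, hw⟩ := h.exists_walk N le_rfl q (q.2.trans_le h.le) hq
  obtain rfl := Fin.ext hq'
  rw [← hw, ← pathLength_reverse]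
  exact iInf_le _ _

theorem le_geodist (h : Relaxation len N top L p D) (q : Fin n) : D N q ≤ geodist len p q := by
  refine le_iInf fun w => ?_
  refine Nat.cast_le.2 ?_
  rw [← pathLength_reverse]
  -- Dropping cycles does not increase the length, and a path has fewer than `n ≤ N` edges, so `N`
  -- rounds suffice.
  refine (h.le_pathLength N le_rfl q w.reverse.bypass ?_).trans (pathLength_bypass_le _)
  have := (w.reverse.bypass_isPath).length_lt
  rw [Fintype.card_fin] at this
  have := h.le
  omega

theorem lt_top (h : Relaxation len N top L p D) {S : ℕ} (hS : ∀ e, len e ≤ S) (hN : N * S < top)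
    {q : Fin n} (hq : geodist len p q ≠ ⊤) : D N q < top := by
  obtain ⟨w⟩ : Nonempty ((oneSkeleton K).Walk p q) := by
    by_contra hw
    rw [not_nonempty_iff] at hw
    exact hq (by rw [geodist, iInf_of_empty])
  have hlt := (w.reverse.bypass_isPath).length_lt
  rw [Fintype.card_fin] at hlt
  have hle := h.le
  refine (h.le_pathLength N le_rfl q w.reverse.bypass (by omega)).trans_lt ?_
  exact (pathLength_le_mul hS _).trans_lt ((Nat.mul_le_mul_right S (by omega)).trans_lt hN)

end Relaxation

end Distance

end CycleLocalization

/-! ### Reasoning about commands on tables -/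

namespace RAM

/-! ### Loops that compute sums, extrema and searches. -/

section Iter

variable {N a : ℕ} {f : ℕ → ℕ}

theorem iter_invariant {α : Type} {f : ℕ → α → α} {a : α} {N : ℕ} (P : ℕ → α → Prop) (h0 : P 0 a)
    (hstep : ∀ k < N, ∀ x, P k x → P (k + 1) (f k x)) : ∀ k ≤ N, P k (iter f a k) := by
  intro k
  induction k with
  | zero => exact fun _ => h0
  | succ k ih => exact fun hk => hstep k hk _ (ih (by omega))

theorem iter_congr {α : Type} {f g : ℕ → α → α} {a : α} {N : ℕ} (h : ∀ k < N, ∀ x, f k x = g k x) :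
    iter f a N = iter g a N := by
  induction N with
  | zero => rfl
  | succ N ih => rw [iter, iter, ih fun k hk => h k (by omega), h N (by omega)]

theorem iter_add : iter (fun k x => x + f k) a N = a + ∑ k ∈ Finset.range N, f k := by
  induction N with
  | zero => simp [iter]
  | succ N ih => rw [iter, ih, Finset.sum_range_succ, add_assoc]

theorem iter_max_le_iff {y : ℕ} :
    iter (fun k x => if x < f k then f k else x) a N ≤ y ↔ a ≤ y ∧ ∀ k < N, f k ≤ y := by
  induction N with
  | zero => simp [iter]
  | succ N ih =>
    rw [iter, Nat.forall_lt_succ_right, ← and_assoc, ← ih]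
    split_ifs with h
    · exact ⟨fun h' => ⟨h.le.trans h', h'⟩, fun h' => h'.2⟩
    · exact ⟨fun h' => ⟨h', (not_lt.1 h).trans h'⟩, fun h' => h'.1⟩

theorem le_iter_min_iff {y : ℕ} :
    y ≤ iter (fun k x => if f k < x then f k else x) a N ↔ y ≤ a ∧ ∀ k < N, y ≤ f k := by
  induction N with
  | zero => simp [iter]
  | succ N ih =>
    rw [iter, Nat.forall_lt_succ_right, ← and_assoc, ← ih]
    split_ifs with h
    · exact ⟨fun h' => ⟨h'.trans h.le, h'⟩, fun h' => h'.2⟩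
    · exact ⟨fun h' => ⟨h', h'.trans (not_lt.1 h)⟩, fun h' => h'.1⟩

/-- The loop keeps the value at the last index with `P`, if any; which index it is does not matter
in the applications. -/
theorem iter_ite_eq (P : ℕ → Prop) [DecidablePred P] :
    (iter (fun k x => if P k then f k else x) a N = a ∧ ∀ k < N, ¬ P k) ∨
      ∃ k < N, P k ∧ iter (fun k x => if P k then f k else x) a N = f k := by
  induction N with
  | zero => simp [iter]
  | succ N ih =>
    rw [iter]
    split_ifs with h
    · exact .inr ⟨N, by omega, h, rfl⟩
    · obtain ⟨h₁, h₂⟩ | ⟨k, hk, h₁, h₂⟩ := ih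
      · exact .inl ⟨h₁, Nat.forall_lt_succ_right.2 ⟨h₂, h⟩⟩
      · exact .inr ⟨k, by omega, h₁, h₂⟩

theorem iter_min_eq :
    iter (fun k x => if f k < x then f k else x) a N = a ∨
      ∃ k < N, iter (fun k x => if f k < x then f k else x) a N = f k := by
  induction N with
  | zero => simp [iter]
  | succ N ih =>
    rw [iter]
    split_ifs with h
    · exact .inr ⟨N, by omega, rfl⟩
    · obtain h | ⟨k, hk, h⟩ := ih
      · exact .inl h
      · exact .inr ⟨k, by omega, h⟩

theorem iter_argmax (hN : 0 < N) :
    iter (fun k x => if f x < f k then k else x) 0 N < N ∧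
      ∀ k < N, f k ≤ f (iter (fun k x => if f x < f k then k else x) 0 N) := by
  suffices h : ∀ M ≤ N, iter (fun k x => if f x < f k then k else x) 0 M < N ∧
      ∀ k < M, f k ≤ f (iter (fun k x => if f x < f k then k else x) 0 M) from h N le_rfl
  intro M
  induction M with
  | zero => simp [iter, hN]
  | succ M ih =>
    intro hM
    obtain ⟨h₁, h₂⟩ := ih (by omega)
    rw [iter, Nat.forall_lt_succ_right]
    split_ifs with h
    · exact ⟨hM, fun k hk => (h₂ k hk).trans h.le, le_rfl⟩
    · exact ⟨h₁, h₂, not_lt.1 h⟩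

end Iter

/-! ### Frame rules for commands. -/

variable {w : List ℕ} {σ : Tables} {env : List ℕ}

/-- The tables that a command may change. -/
def Cmd.writes : Cmd → List ℕ
  | .assign a _ => [a]
  | .seq c₁ c₂ => c₁.writes ++ c₂.writes
  | .loop c => c.writes

theorem Cmd.exec_of_notMem (c : Cmd) {a : ℕ} (ha : a ∉ c.writes) :
    c.exec w env σ a = σ a := by
  induction c generalizing env σ with
  | assign b e =>
    rw [Cmd.writes, List.mem_singleton] at ha
    exact Function.update_of_ne ha _ _
  | seq c₁ c₂ ih₁ ih₂ =>
    rw [Cmd.writes, List.mem_append, not_or] at ha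
    rw [Cmd.exec, ih₂ ha.2, ih₁ ha.1]
  | loop c ih =>
    exact iter_invariant (fun (_ : ℕ) (σ' : Tables) => σ' a = σ a) rfl
      (fun k _ x hx => (ih ha).trans hx) _ le_rfl

/-- Allows identities between table entries to be stated for all natural indices, so that tables
become vectors in `ℕ → ZMod 2`. -/
theorem Cmd.exec_zero_outside (c : Cmd)
    (h : ∀ a i j, ¬ (i < w.length ∧ j < w.length) → σ a i j = 0) :
    ∀ a i j, ¬ (i < w.length ∧ j < w.length) → c.exec w env σ a i j = 0 := by
  induction c generalizing env σ with
  | assign b e =>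
    intro a i j hij
    by_cases hab : a = b
    · subst hab
      simp only [Cmd.exec, Function.update_self, mkTable, if_neg hij]
    · simpa [Cmd.exec, hab] using h a i j hij
  | seq c₁ c₂ ih₁ ih₂ => exact ih₂ (ih₁ h)
  | loop c ih =>
    exact iter_invariant (fun (_ : ℕ) (σ' : Tables) => ∀ a i j,
      ¬ (i < w.length ∧ j < w.length) → σ' a i j = 0) h (fun k _ x hx => ih hx) _ le_rfl

theorem Cmd.exec_assign {a : ℕ} {e : Expr} (f : ℕ → ℕ → ℕ)
    (h : ∀ i < w.length, ∀ j < w.length, e.eval w σ (i :: j :: env) = f i j) :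
    (Cmd.assign a e).exec w env σ = Function.update σ a (mkTable w.length f) := by
  rw [Cmd.exec]
  congr 1
  funext i j
  rw [mkTable, mkTable]
  split_ifs with hij
  · exact h i hij.1 j hij.2
  · rfl

theorem mkTable_of_lt {N : ℕ} {f : ℕ → ℕ → ℕ} {i j : ℕ} (hi : i < N) (hj : j < N) :
    mkTable N f i j = f i j := if_pos ⟨hi, hj⟩

/-! #### Derived expressions -/

namespace Expr

/-- Nonzero if the value of `e₁` is less than that of `e₂`. -/
def lt (e₁ e₂ : Expr) : Expr := .sub e₂ e₁

/-- Nonzero if the values differ. -/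
def ne (e₁ e₂ : Expr) : Expr := .add (.sub e₁ e₂) (.sub e₂ e₁)

/-- Nonzero if both values are. -/
def and (e₁ e₂ : Expr) : Expr := .ite e₁ e₂ (.const 0)

/-- The sum modulo `2` of two bits. -/
def xor (e₁ e₂ : Expr) : Expr := .ite e₁ (.sub (.const 1) e₂) e₂

/-- The entry of table `a` in row `e` and column `0`. -/
def load₁ (a : ℕ) (e : Expr) : Expr := .load a e (.const 0)

/-- The entry of table `a` in row `0` and column `0`. -/
def load₀ (a : ℕ) : Expr := .load a (.const 0) (.const 0)

@[simp] theorem eval_const (k : ℕ) : (Expr.const k).eval w σ env = k := rfl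
@[simp] theorem eval_input (e : Expr) : (Expr.input e).eval w σ env = w.getD (e.eval w σ env) 0 :=
  rfl
@[simp] theorem eval_add (e₁ e₂ : Expr) :
    (Expr.add e₁ e₂).eval w σ env = e₁.eval w σ env + e₂.eval w σ env := rfl
@[simp] theorem eval_sub (e₁ e₂ : Expr) :
    (Expr.sub e₁ e₂).eval w σ env = e₁.eval w σ env - e₂.eval w σ env := rfl
@[simp] theorem eval_ite (c e₁ e₂ : Expr) : (Expr.ite c e₁ e₂).eval w σ env =
    if c.eval w σ env ≠ 0 then e₁.eval w σ env else e₂.eval w σ env := rfl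
@[simp] theorem eval_load (a : ℕ) (e₁ e₂ : Expr) :
    (Expr.load a e₁ e₂).eval w σ env = σ a (e₁.eval w σ env) (e₂.eval w σ env) := rfl
@[simp] theorem eval_load₁ (a : ℕ) (e : Expr) :
    (load₁ a e).eval w σ env = σ a (e.eval w σ env) 0 := rfl
@[simp] theorem eval_load₀ (a : ℕ) : (load₀ a).eval w σ env = σ a 0 0 := rfl
theorem eval_fold (e₀ e : Expr) : (Expr.fold e₀ e).eval w σ env =
    iter (fun k x => e.eval w σ (x :: k :: env)) (e₀.eval w σ env) w.length := rfl

@[simp] theorem eval_lt_ne_zero (e₁ e₂ : Expr) :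
    (lt e₁ e₂).eval w σ env ≠ 0 ↔ e₁.eval w σ env < e₂.eval w σ env := by
  simp only [lt, eval_sub]
  omega

@[simp] theorem eval_ne_ne_zero (e₁ e₂ : Expr) :
    (ne e₁ e₂).eval w σ env ≠ 0 ↔ e₁.eval w σ env ≠ e₂.eval w σ env := by
  simp only [ne, eval_sub, eval_add]
  omega

@[simp] theorem eval_and_ne_zero (e₁ e₂ : Expr) :
    (and e₁ e₂).eval w σ env ≠ 0 ↔ e₁.eval w σ env ≠ 0 ∧ e₂.eval w σ env ≠ 0 := by
  simp only [and, eval_ite, eval_const]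
  split_ifs with h <;> simp [h]

end Expr

/-! ### Bits as elements of `ZMod 2`. -/

/-- The sum modulo `2` of two bits. -/
def bitXor (a b : ℕ) : ℕ := if a ≠ 0 then 1 - b else b

/-- The product of two bits. -/
def bitAnd (a b : ℕ) : ℕ := if a ≠ 0 then b else 0

@[simp] theorem Expr.eval_xor (e₁ e₂ : Expr) :
    (Expr.xor e₁ e₂).eval w σ env = bitXor (e₁.eval w σ env) (e₂.eval w σ env) := rfl

theorem Expr.eval_and (e₁ e₂ : Expr) :
    (Expr.and e₁ e₂).eval w σ env = bitAnd (e₁.eval w σ env) (e₂.eval w σ env) := rfl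

theorem bitXor_le_one {a b : ℕ} (hb : b ≤ 1) : bitXor a b ≤ 1 := by
  unfold bitXor
  split_ifs <;> omega

theorem bitAnd_le_one {a b : ℕ} (hb : b ≤ 1) : bitAnd a b ≤ 1 := by
  unfold bitAnd
  split_ifs <;> omega

theorem cast_bitXor {a b : ℕ} (ha : a ≤ 1) (hb : b ≤ 1) :
    ((bitXor a b : ℕ) : ZMod 2) = a + b := by
  interval_cases a <;> interval_cases b <;> decide

theorem cast_bitAnd {a b : ℕ} (ha : a ≤ 1) : ((bitAnd a b : ℕ) : ZMod 2) = a * b := by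
  interval_cases a <;> simp [bitAnd]

theorem natCast_zmod_two_ne_zero {a : ℕ} (ha : a ≤ 1) : (a : ZMod 2) ≠ 0 ↔ a ≠ 0 := by
  interval_cases a <;> simp

end RAM

namespace CycleLocalization

/-! ### The encoded instance -/

theorem getD_flatMap {α : Type} {L : ℕ} (f : α → List ℕ) (l : List α) (hf : ∀ a, (f a).length = L)
    {i j : ℕ} (hi : i < l.length) (hj : j < L) :
    (l.flatMap f).getD (i * L + j) 0 = (f l[i]).getD j 0 := by
  induction l generalizing i with
  | nil => simp at hi
  | cons a l ih =>
    rw [List.flatMap_cons]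
    cases i with
    | zero =>
      rw [Nat.zero_mul, zero_add, List.getD_append _ _ _ _ (by rw [hf]; exact hj)]
      rfl
    | succ i =>
      rw [List.getD_append_right _ _ _ _ (by rw [hf, Nat.succ_mul]; omega), hf,
        show (i + 1) * L + j - L = i * L + j by rw [Nat.succ_mul]; omega,
        ih (by simpa using hi)]
      rfl

namespace Instance

variable (I : Instance)

/-- The number of simplices. -/
abbrev numSimplices : ℕ := I.simplices.length

/-- The length of the input word. -/
abbrev inputLength : ℕ := I.encode.length

/-- The `i`-th simplex, empty if there is none. -/
def face (i : ℕ) : Finset (Fin I.n) := if h : i < I.numSimplices then (I.simplices[i]).1 else ∅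

/-- The value at the `i`-th simplex of a function on the simplices with `k` vertices. -/
def atIndex {M : Type} [Zero M] {k : ℕ} (f : Simplex I.K k → M) (i : ℕ) : M :=
  if h : i < I.numSimplices then valueAt f I.simplices[i] else 0

/-- The incidence of the vertex `v` with the `i`-th simplex. -/
def bit (i v : ℕ) : ℕ := if v ∈ (I.face i).image Fin.val then 1 else 0

variable {I}

theorem length_block (σ : {σ : Finset (Fin I.n) // σ ∈ I.K.faces}) :
    ((List.ofFn fun v : Fin I.n => if v ∈ σ.1 then 1 else 0) ++
      [valueAt I.len σ, (valueAt I.z₀.1 σ).val]).length = I.n + 2 := by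
  simp

theorem inputLength_eq : I.inputLength = 3 + I.numSimplices * (I.n + 2) := by
  simp only [inputLength, encode, List.length_cons, List.length_flatMap, length_block,
    List.map_const', List.sum_replicate, smul_eq_mul, numSimplices]
  omega

theorem getD_encode {i j : ℕ} (hi : i < I.numSimplices) (hj : j < I.n + 2) :
    I.encode.getD (3 + i * (I.n + 2) + j) 0 =
      ((List.ofFn fun v : Fin I.n => if v ∈ (I.simplices[i]).1 then 1 else 0) ++
        [valueAt I.len I.simplices[i], (valueAt I.z₀.1 I.simplices[i]).val]).getD j 0 := by
  rw [← getD_flatMap (L := I.n + 2) _ I.simplices length_block hi hj, encode,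
    show 3 + i * (I.n + 2) + j = i * (I.n + 2) + j + 1 + 1 + 1 by omega]
  rfl

theorem numSimplices_le : I.numSimplices ≤ I.inputLength := by
  rw [inputLength_eq]
  nlinarith [Nat.zero_le (I.numSimplices * I.n)]

/-- As soon as there is a vertex, the list contains a simplex, and the block of a single simplex is
already longer than `n`. Hence loops of length `N` reach all vertices. -/
theorem n_le_inputLength : I.n ≤ I.inputLength := by
  obtain h | h := Nat.eq_zero_or_pos I.n
  · omega
  · have := List.length_pos_of_mem (I.complete ⟨_, I.K.singleton_mem ⟨0, h⟩⟩)
    rw [inputLength_eq]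
    change 0 < I.numSimplices at this
    nlinarith

theorem inputLength_pos : 0 < I.inputLength := by
  rw [inputLength_eq]
  omega

theorem mem_face_iff {i : ℕ} {v : Fin I.n} : I.bit i v ≠ 0 ↔ v ∈ I.face i := by
  simp [bit, Fin.val_inj]

theorem bit_ne_zero_iff {i v : ℕ} : I.bit i v ≠ 0 ↔ ∃ v' ∈ I.face i, v'.1 = v := by
  simp [bit]

theorem getD_bit {i v : ℕ} (hi : i < I.numSimplices) (hv : v < I.n) :
    I.encode.getD (3 + i * (I.n + 2) + v) 0 = I.bit i v := by
  rw [getD_encode hi (by omega), List.getD_append _ _ _ _ (by simpa using hv),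
    List.getD_eq_getElem _ _ (by simpa using hv), List.getElem_ofFn]
  simp only [bit, face, dif_pos hi, Finset.mem_image]
  congr 1
  refine propext ⟨fun h => ⟨_, h, rfl⟩, ?_⟩
  rintro ⟨v', h, rfl⟩
  exact h

theorem getD_len {i : ℕ} (hi : i < I.numSimplices) :
    I.encode.getD (3 + i * (I.n + 2) + I.n) 0 = I.atIndex I.len i := by
  rw [getD_encode hi (by omega), List.getD_append_right _ _ _ _ (by simp)]
  simp [atIndex, hi]

theorem getD_cycle {i : ℕ} (hi : i < I.numSimplices) :
    I.encode.getD (3 + i * (I.n + 2) + (I.n + 1)) 0 = (I.atIndex I.z₀.1 i).val := by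
  rw [getD_encode hi (by omega), List.getD_append_right _ _ _ _ (by simp)]
  simp [atIndex, hi]

theorem face_of_le {i : ℕ} (hi : I.numSimplices ≤ i) : I.face i = ∅ := dif_neg (by omega)

theorem bit_eq_zero_of_le {i v : ℕ} (h : I.numSimplices ≤ i ∨ I.n ≤ v) : I.bit i v = 0 := by
  by_contra h'
  obtain ⟨v', hv', rfl⟩ := bit_ne_zero_iff.1 h'
  obtain h | h := h
  · simp [face_of_le h] at hv'
  · exact absurd v'.2 (by omega)

theorem sum_bit (i : ℕ) {N : ℕ} (hN : I.n ≤ N) :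
    ∑ v ∈ Finset.range N, I.bit i v = (I.face i).card := by
  rw [← Finset.card_image_of_injective (I.face i) Fin.val_injective]
  simp only [bit]
  rw [Finset.sum_boole, Finset.filter_mem_eq_inter, Finset.inter_eq_right.2]
  · rfl
  · intro v hv
    obtain ⟨v', -, rfl⟩ := Finset.mem_image.1 hv
    exact Finset.mem_range.2 (v'.2.trans_le hN)

theorem face_mem {i : ℕ} (hi : (I.face i).Nonempty) : I.face i ∈ I.K.faces := by
  unfold face at hi ⊢
  split_ifs at hi ⊢ with h
  · exact (I.simplices[i]).2
  · simp at hi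

theorem exists_face_eq {s : Finset (Fin I.n)} (hs : s ∈ I.K.faces) :
    ∃ i < I.numSimplices, I.face i = s := by
  obtain ⟨i, hi, h⟩ := List.getElem_of_mem (I.complete ⟨s, hs⟩)
  exact ⟨i, hi, by rw [face, dif_pos hi, h]⟩

theorem atIndex_eq {M : Type} [Zero M] {k : ℕ} (f : Simplex I.K k → M) {i : ℕ}
    (σ : Simplex I.K k) (h : I.face i = σ.1) : I.atIndex f i = f σ := by
  have hσ : σ.1.Nonempty := (I.K.isRelLowerSet_faces σ.2.1).1
  by_cases hi : i < I.numSimplices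
  · rw [face, dif_pos hi] at h
    rw [atIndex, dif_pos hi, valueAt, dif_pos (by rw [h, σ.2.2])]
    congr 1
    exact Subtype.ext h
  · rw [face_of_le (by omega)] at h
    simp [← h] at hσ

theorem atIndex_of_card_ne {M : Type} [Zero M] {k : ℕ} (f : Simplex I.K k → M) {i : ℕ}
    (h : i < I.numSimplices → (I.face i).card ≠ k) : I.atIndex f i = 0 := by
  unfold atIndex
  split_ifs with hi
  · have := h hi
    rw [face, dif_pos hi] at this
    rw [valueAt, dif_neg this]
  · rfl

theorem exists_simplex_of_card {k : ℕ} {i : ℕ} (hk : 0 < k) (h : (I.face i).card = k) :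
    ∃ σ : Simplex I.K k, I.face i = σ.1 :=
  ⟨⟨I.face i, face_mem (Finset.card_pos.1 (by omega)), h⟩, rfl⟩

theorem exists_of_atIndex_ne_zero {M : Type} [Zero M] {k : ℕ} {f : Simplex I.K k → M} {i : ℕ}
    (h : I.atIndex f i ≠ 0) : ∃ σ : Simplex I.K k, I.face i = σ.1 ∧ f σ ≠ 0 := by
  by_cases hi : i < I.numSimplices
  · by_cases hc : (I.face i).card = k
    · have hne : (I.face i).Nonempty := by
        rw [face, dif_pos hi]
        exact (I.K.isRelLowerSet_faces (I.simplices[i]).2).1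
      refine ⟨⟨I.face i, face_mem hne, hc⟩, rfl, ?_⟩
      rwa [← atIndex_eq f ⟨I.face i, face_mem hne, hc⟩ rfl]
    · exact absurd (atIndex_of_card_ne f fun _ => hc) h
  · exact absurd (atIndex_of_card_ne f fun h => absurd h hi) h

/-! ### Homology classes as cosets of coordinate vectors. -/

/-- Chains as vectors indexed by the positions of the simplices. -/
def chainVector (I : Instance) (k : ℕ) : Chain I.K k →ₗ[ZMod 2] (ℕ → ZMod 2) where
  toFun c i := I.atIndex c i
  map_add' c c' := by
    funext i
    simp only [atIndex, valueAt, Pi.add_apply]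
    split_ifs <;> simp
  map_smul' a c := by
    funext i
    simp only [atIndex, valueAt, Pi.smul_apply]
    split_ifs <;> simp

/-- The boundaries as vectors. -/
noncomputable def boundaryVectors (I : Instance) : Submodule (ZMod 2) (ℕ → ZMod 2) :=
  (Boundaries I.K I.d).map (I.chainVector (I.d + 1))

theorem lt_of_mem_boundaryVectors {y : ℕ → ZMod 2} (hy : y ∈ I.boundaryVectors) {r : ℕ}
    (hr : y r ≠ 0) : r < I.inputLength := by
  obtain ⟨c, -, rfl⟩ := hy
  by_contra h
  exact hr (dif_neg fun h' => h (h'.trans_le numSimplices_le))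

/-- The coefficient of the `j`-th simplex in the boundary of the `i`-th one, if they have the
dimensions `d` and `d + 1`. -/
def boundaryEntry (I : Instance) (i j : ℕ) : ℕ :=
  if (I.face i).card = I.d + 2 ∧ (I.face j).card = I.d + 1 ∧ I.face j ⊆ I.face i then 1 else 0

/-- A row belonging to a `(d + 1)`-simplex is the boundary of that simplex, and all other rows are
zero; boundaries of single simplices generate all boundaries. -/
theorem span_boundaryEntry :
    Submodule.span (ZMod 2) (Set.range fun i j => (I.boundaryEntry i j : ZMod 2)) =
      I.boundaryVectors := by
  have hrow : ∀ i (τ : Simplex I.K (I.d + 2)), I.face i = τ.1 →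
      (fun j => (I.boundaryEntry i j : ZMod 2)) =
        I.chainVector (I.d + 1) (boundary I.K (I.d + 1) (Pi.single τ 1)) := by
    intro i τ hτ
    funext j
    change _ = I.atIndex _ j
    by_cases hj : (I.face j).card = I.d + 1
    · obtain ⟨σ, hσ⟩ := exists_simplex_of_card (by omega) hj
      rw [atIndex_eq _ σ hσ, boundary_single]
      simp [boundaryEntry, hσ, hτ, τ.2.2, σ.2.2]
    · rw [atIndex_of_card_ne _ fun _ => hj]
      simp [boundaryEntry, hj]
  rw [boundaryVectors, ← span_boundary_single, Submodule.map_span, ← Set.range_comp]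
  refine le_antisymm (Submodule.span_le.2 ?_) (Submodule.span_mono ?_)
  · rintro _ ⟨i, rfl⟩
    by_cases hi : (I.face i).card = I.d + 2
    · obtain ⟨τ, hτ⟩ := exists_simplex_of_card (by omega) hi
      exact Submodule.subset_span ⟨τ, (hrow i τ hτ).symm⟩
    · have h0 : (fun j => (I.boundaryEntry i j : ZMod 2)) = 0 := by
        funext j
        simp [boundaryEntry, hi]
      simp only [h0]
      exact zero_mem _
  · rintro _ ⟨τ, rfl⟩
    obtain ⟨i, -, hi⟩ := exists_face_eq τ.2.1
    exact ⟨i, hrow i τ hi⟩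

theorem homologyClass_eq_iff {n d : ℕ} {K : AbstractSimplicialComplex (Fin n)}
    {z z' : Cycles K d} : homologyClass K z = homologyClass K z' ↔ z.1 - z'.1 ∈ Boundaries K d := by
  rw [homologyClass, homologyClass, Submodule.Quotient.eq]
  rfl

theorem exists_cycle {z : ℕ → ZMod 2}
    (hz : z - I.chainVector _ I.z₀.1 ∈ I.boundaryVectors) :
    ∃ z' : Cycles I.K I.d, homologyClass I.K z' = homologyClass I.K I.z₀ ∧
      I.chainVector _ z'.1 = z := by
  obtain ⟨b, ⟨c, rfl⟩, hb⟩ := hz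
  refine ⟨⟨I.z₀.1 + boundary I.K (I.d + 1) c, ?_⟩, ?_, ?_⟩
  · have := I.z₀.2
    rw [LinearMap.mem_ker] at this ⊢
    rw [map_add, this, boundary_boundary, add_zero]
  · rw [homologyClass_eq_iff, add_sub_cancel_left]
    exact ⟨c, rfl⟩
  · rw [map_add, hb, add_sub_cancel]

theorem mem_boundaryVectors_of_homologyClass_eq {z : Cycles I.K I.d}
    (hz : homologyClass I.K z = homologyClass I.K I.z₀) :
    I.chainVector _ z.1 - I.chainVector _ I.z₀.1 ∈ I.boundaryVectors := by
  rw [← map_sub]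
  exact Submodule.mem_map_of_mem (homologyClass_eq_iff.1 hz)

theorem mem_chainVertices_iff {k : ℕ} {c : Chain I.K k} {q : Fin I.n} :
    q ∈ chainVertices c ↔ ∃ i, I.chainVector k c i ≠ 0 ∧ q ∈ I.face i := by
  constructor
  · rintro ⟨σ, hσ, hq⟩
    obtain ⟨i, -, hi⟩ := exists_face_eq σ.2.1
    exact ⟨i, by change I.atIndex c i ≠ 0; rwa [atIndex_eq c σ hi], by rwa [hi]⟩
  · rintro ⟨i, hi, hq⟩
    obtain ⟨σ, hσ, hc⟩ := exists_of_atIndex_ne_zero hi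
    exact ⟨σ, hc, by rwa [← hσ]⟩

/-- A vector in the class of the given cycle, with all its vertices within distance `best` of a
vertex, is optimal if `best` is a lower bound for all centers and all vectors of the class; `top`
stands for infinity. -/
theorem exists_minRadiusCycle {z : ℕ → ZMod 2} {best top : ℕ}
    (hz : z - I.chainVector _ I.z₀.1 ∈ I.boundaryVectors)
    (hbest : best < top → ∃ p, ∀ i, z i ≠ 0 → ∀ q ∈ I.face i, geodist I.len p q ≤ best)
    (hle : ∀ p, ∀ z' : ℕ → ZMod 2, z' - I.chainVector _ I.z₀.1 ∈ I.boundaryVectors → ∀ x : ℕ,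
      (∀ i, z' i ≠ 0 → ∀ q ∈ I.face i, geodist I.len p q ≤ x) → best ≤ x ∧ best < top) :
    ∃ z' : Cycles I.K I.d, IsMinRadiusCycle I.len (homologyClass I.K I.z₀) z' ∧
      I.chainVector _ z'.1 = z := by
  obtain ⟨z', hz', rfl⟩ := exists_cycle hz
  refine ⟨z', ⟨hz', fun z'' hz'' => le_iInf fun p => ?_⟩, rfl⟩
  -- An infinite competitor is trivial; a finite one turns the supremum into a natural number `x` to
  -- which the lower bound applies.
  by_cases htop : (⨆ q ∈ chainVertices z''.1, geodist I.len p q) = ⊤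
  · rw [htop]
    exact le_top
  obtain ⟨x, hx⟩ := ENat.ne_top_iff_exists.1 htop
  obtain ⟨h₁, h₂⟩ := hle p _ (mem_boundaryVectors_of_homologyClass_eq hz'') x fun i hi q hq => by
    rw [hx]
    exact le_iSup₂_of_le q (mem_chainVertices_iff.2 ⟨i, hi, hq⟩) le_rfl
  obtain ⟨p', hp'⟩ := hbest h₂
  rw [← hx]
  refine (iInf_le _ p').trans (le_trans (iSup₂_le fun q hq => ?_) (Nat.cast_le.2 h₁))
  obtain ⟨i, hi, hq⟩ := mem_chainVertices_iff.1 hq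
  exact hp' i hi q hq

end Instance

end CycleLocalization

open RAM RAM.Expr

namespace RAM

/-! ### The algorithm

The tables, those with one index being constant along the rows, and those without index being
constant:
`0` incidences of simplices and vertices, `1` edge lengths by simplex, `2` the given cycle,
`3` cardinalities of the simplices, `4` a number that stands for infinity, `5` edge lengths by pairs
of vertices, `6` boundary matrix, `7` distances from the center, `8` weights of the simplices,
`9` reduced matrix, `10` reduced cycle, `11` treated coordinates, `12` priorities,
`13` pivot column, `14` pivot row, `15` weight of the reduced cycle, `16` least weight so far, `17` best cycle so far,
`18` sum of the input word. -/

namespace Expr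

@[simp] theorem eval_var_zero {w : List ℕ} {σ : Tables} {a : ℕ} {l : List ℕ} :
    (var 0).eval w σ (a :: l) = a := rfl
@[simp] theorem eval_var_one {w : List ℕ} {σ : Tables} {a b : ℕ} {l : List ℕ} :
    (var 1).eval w σ (a :: b :: l) = b := rfl
@[simp] theorem eval_var_two {w : List ℕ} {σ : Tables} {a b c : ℕ} {l : List ℕ} :
    (var 2).eval w σ (a :: b :: c :: l) = c := rfl
@[simp] theorem eval_var_three {w : List ℕ} {σ : Tables} {a b c d : ℕ} {l : List ℕ} :
    (var 3).eval w σ (a :: b :: c :: d :: l) = d := rfl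

/-- The number of vertices. -/
def numVertices : Expr := .input (.const 0)

/-- The dimension. -/
def dimension : Expr := .input (.const 1)

/-- The number of simplices. -/
def numSimplices : Expr := .input (.const 2)

/-- The position in the input of the description of simplex number `var 0`. -/
def position : Expr :=
  .fold (.const 3) (.ite (lt (.var 1) (.var 2)) (.add (.var 0) (.add numVertices (.const 2)))
    (.var 0))

/-- The maximum of `0` and the values of `e`, in which variable `1` is the index. -/
def maximum (e : Expr) : Expr := .fold (.const 0) (.ite (lt (.var 0) e) e (.var 0))

end Expr

namespace Cmd

/-- Fill in the tables that depend on the input only, and initialize the result. -/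
def prepare : Cmd :=
  .seq (.assign 0 (.ite (Expr.and (lt (.var 0) Expr.numSimplices) (lt (.var 1) numVertices))
    (.input (.add position (.var 1))) (.const 0))) <|
  .seq (.assign 1 (.ite (lt (.var 0) Expr.numSimplices) (.input (.add position numVertices))
    (.const 0))) <|
  .seq (.assign 2 (.ite (lt (.var 0) Expr.numSimplices)
    (.input (.add position (.add numVertices (.const 1)))) (.const 0))) <|
  .seq (.assign 3 (.fold (.const 0) (.add (.var 0) (.load 0 (.var 2) (.var 1))))) <|
  .seq (.assign 18 (.fold (.const 0) (.add (.var 0) (.input (.var 1))))) <|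
  .seq (.assign 4 (.fold (.const 1) (.add (.var 0) (load₀ 18)))) <|
  .seq (.assign 5 (.fold (load₀ 4)
    (.ite (Expr.ne (load₁ 3 (.var 1)) (.const 2)) (.var 0) <|
      .ite (Expr.and (Expr.ne (.var 2) (.var 3))
        (Expr.and (.load 0 (.var 1) (.var 2)) (.load 0 (.var 1) (.var 3))))
      (load₁ 1 (.var 1)) (.var 0)))) <|
  .seq (.assign 6 (.ite (Expr.ne (load₁ 3 (.var 0)) (.add dimension (.const 2))) (.const 0) <|
    .ite (Expr.ne (load₁ 3 (.var 1)) (.add dimension (.const 1))) (.const 0) <|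
    .fold (.const 1) (.ite (.load 0 (.var 3) (.var 1))
      (.ite (.load 0 (.var 2) (.var 1)) (.var 0) (.const 0)) (.var 0)))) <|
  .seq (.assign 16 (load₀ 4)) (.assign 17 (load₁ 2 (.var 0)))

/-- One round of relaxation of the distances. -/
def relax : Cmd :=
  .assign 7 (.fold (load₁ 7 (.var 0))
    (.ite (lt (.add (load₁ 7 (.var 1)) (.load 5 (.var 1) (.var 2))) (.var 0))
      (.add (load₁ 7 (.var 1)) (.load 5 (.var 1) (.var 2))) (.var 0)))

/-- Treat the coordinate of largest weight among those not yet treated. -/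
def eliminate : Cmd :=
  .seq (.assign 12 (.ite (load₁ 11 (.var 0)) (.const 0) (.add (load₁ 8 (.var 0)) (.const 1)))) <|
  .seq (.assign 13 (.fold (.const 0)
    (.ite (lt (load₁ 12 (.var 0)) (load₁ 12 (.var 1))) (.var 1) (.var 0)))) <|
  .seq (.assign 14 (.fold (.const 0)
    (.ite (lt (.load 9 (.var 0) (load₀ 13)) (.load 9 (.var 1) (load₀ 13))) (.var 1) (.var 0)))) <|
  .seq (.assign 10 (Expr.xor (load₁ 10 (.var 0))
    (Expr.and (Expr.and (load₁ 10 (load₀ 13)) (.load 9 (load₀ 14) (load₀ 13)))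
      (.load 9 (load₀ 14) (.var 0))))) <|
  .seq (.assign 9 (Expr.xor (.load 9 (.var 0) (.var 1))
    (Expr.and (.load 9 (.var 0) (load₀ 13)) (.load 9 (load₀ 14) (.var 1)))))
  (.assign 11 (.ite (Expr.ne (.var 0) (load₀ 13)) (load₁ 11 (.var 0)) (.const 1)))

/-- Compute the distances from the center `var 0`. -/
def distances : Cmd :=
  .seq (.assign 7 (.ite (Expr.ne (.var 0) (.var 2)) (load₀ 4) (.const 0))) (.loop relax)

/-- Compute a cycle of least weight for the given distances. -/
def reduce : Cmd :=
  .seq (.assign 8 (maximum (.ite (.load 0 (.var 2) (.var 1)) (load₁ 7 (.var 1)) (.const 0)))) <|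
  .seq (.assign 9 (.load 6 (.var 0) (.var 1))) <|
  .seq (.assign 10 (load₁ 2 (.var 0))) <|
  .seq (.assign 11 (.const 0)) <|
  .seq (.loop eliminate)
  (.assign 15 (maximum (.ite (load₁ 10 (.var 1)) (load₁ 8 (.var 1)) (.const 0))))

/-- Keep the cycle for the center `var 0` if it is better than the previous ones. -/
def keepBest : Cmd :=
  .seq (.assign 17 (.ite (Expr.and (lt (.var 2) numVertices) (lt (load₀ 15) (load₀ 16)))
    (load₁ 10 (.var 0)) (load₁ 17 (.var 0))))
  (.assign 16 (.ite (Expr.and (lt (.var 2) numVertices) (lt (load₀ 15) (load₀ 16)))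
    (load₀ 15) (load₀ 16)))

/-- Treat the center `var 0`. -/
def treatCenter : Cmd := .seq distances (.seq reduce keepBest)

/-- The whole algorithm. -/
def minRadiusCycle : Cmd := .seq prepare (.loop treatCenter)

/-! ### Effect of the individual commands. -/

variable {w : List ℕ} {σ : Tables} {env : List ℕ}

theorem eval_maximum_le_iff {e : Expr} {f : ℕ → ℕ}
    (he : ∀ k < w.length, ∀ x, e.eval w σ (x :: k :: env) = f k) {y : ℕ} :
    (maximum e).eval w σ env ≤ y ↔ ∀ k < w.length, f k ≤ y := by
  rw [maximum, eval_fold, iter_congr (g := fun k x => if x < f k then f k else x),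
    iter_max_le_iff]
  · simp
  · intro k hk x
    simp [he k hk x]

theorem exec_relax :
    relax.exec w env σ = Function.update σ 7 (mkTable w.length fun v _ =>
      iter (fun u x => if σ 7 u 0 + σ 5 u v < x then σ 7 u 0 + σ 5 u v else x) (σ 7 v 0)
        w.length) := by
  refine exec_assign _ fun i hi j hj => ?_
  simp [eval_fold]

theorem exec_eliminate (hw : 0 < w.length) : ∃ s < w.length, ∃ t < w.length,
    (∀ i < w.length, (if σ 11 i 0 ≠ 0 then 0 else σ 8 i 0 + 1) ≤
      if σ 11 s 0 ≠ 0 then 0 else σ 8 s 0 + 1) ∧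
    (∀ i < w.length, σ 9 i s ≤ σ 9 t s) ∧
    (∀ i < w.length, ∀ j < w.length, eliminate.exec w env σ 9 i j =
      bitXor (σ 9 i j) (bitAnd (σ 9 i s) (σ 9 t j))) ∧
    (∀ i < w.length, eliminate.exec w env σ 10 i 0 =
      bitXor (σ 10 i 0) (bitAnd (bitAnd (σ 10 s 0) (σ 9 t s)) (σ 9 t i))) ∧
    ∀ i < w.length, eliminate.exec w env σ 11 i 0 = if i = s then 1 else σ 11 i 0 := by
  -- The priority is the weight plus one for untreated coordinates and `0` for treated ones, so even
  -- an untreated coordinate of weight `0` comes before every treated one.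
  set K : ℕ → ℕ := fun i => if σ 11 i 0 ≠ 0 then 0 else σ 8 i 0 + 1 with hK
  set s := iter (fun k x => if mkTable w.length (fun i _ => K i) x 0 <
    mkTable w.length (fun i _ => K i) k 0 then k else x) 0 w.length with hs
  set t := iter (fun k x => if σ 9 x s < σ 9 k s then k else x) 0 w.length with ht
  obtain ⟨hsN, hsmax⟩ := iter_argmax (f := fun i => mkTable w.length (fun i _ => K i) i 0) hw
  obtain ⟨htN, htmax⟩ := iter_argmax (f := fun i => σ 9 i s) hw
  rw [← hs] at hsN hsmax
  rw [← ht] at htN htmax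
  refine ⟨s, hsN, t, htN, fun i hi => ?_, htmax, ?_⟩
  · have := hsmax i hi
    simpa only [mkTable_of_lt hi hw, mkTable_of_lt hsN hw] using this
  -- Table `10` is updated before table `9`, as it needs the pivot row that the update of `9`
  -- clears.
  have key : eliminate.exec w env σ = Function.update (Function.update (Function.update
      (Function.update (Function.update (Function.update σ 12 (mkTable w.length fun i _ => K i))
      13 (mkTable w.length fun _ _ => s)) 14 (mkTable w.length fun _ _ => t))
      10 (mkTable w.length fun i _ =>
        bitXor (σ 10 i 0) (bitAnd (bitAnd (σ 10 s 0) (σ 9 t s)) (σ 9 t i))))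
      9 (mkTable w.length fun i j => bitXor (σ 9 i j) (bitAnd (σ 9 i s) (σ 9 t j))))
      11 (mkTable w.length fun i _ => if i = s then 1 else σ 11 i 0) := by
    rw [eliminate]
    simp only [Cmd.exec.eq_2]
    rw [exec_assign (a := 12) (fun i _ => K i) fun i hi j hj => rfl,
      exec_assign (a := 13) (fun _ _ => s) fun i hi j hj => by simp [eval_fold, hs],
      exec_assign (a := 14) (fun _ _ => t) fun i hi j hj => by
        simp [eval_fold, ht, mkTable_of_lt hw hw],
      exec_assign (a := 10) _ fun i hi j hj => by
        simp [eval_and, mkTable_of_lt hw hw]; rfl,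
      exec_assign (a := 9) _ fun i hi j hj => by
        simp [eval_and, mkTable_of_lt hw hw]; rfl,
      exec_assign (a := 11) _ fun i hi j hj => by
        simp [mkTable_of_lt hw hw]; rfl]
  rw [key]
  refine ⟨fun i hi j hj => ?_, fun i hi => ?_, fun i hi => ?_⟩
  · simp [mkTable_of_lt hi hj]
  · simp [mkTable_of_lt hi hw]
  · simp [mkTable_of_lt hi hw]

end Cmd

end RAM

namespace CycleLocalization

namespace Instance

variable {I : Instance}

/-! ### Correctness of the algorithm -/

/-- A bound for the lengths of all edges. -/
def lengthBound (I : Instance) : ℕ := ∑ k ∈ Finset.range I.inputLength, I.encode.getD k 0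

/-- A number larger than all finite distances. -/
def top (I : Instance) : ℕ := 1 + I.inputLength * I.lengthBound

/-- The length of the edge with the vertices `u` and `v`, or `top` if there is none. -/
def edgeLength (I : Instance) (u v : ℕ) : ℕ :=
  iter (fun k x => if (I.face k).card = 2 ∧ u ≠ v ∧ I.bit k u ≠ 0 ∧ I.bit k v ≠ 0 then
    I.atIndex I.len k else x) I.top I.inputLength

/-- Every edge length is an entry of the input word, and the bound is the sum of all entries. -/
theorem len_le_lengthBound (e : Simplex I.K 2) : I.len e ≤ I.lengthBound := by
  obtain ⟨i, hi, h⟩ := exists_face_eq e.2.1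
  rw [← atIndex_eq I.len e h, ← getD_len hi]
  refine Finset.single_le_sum (f := fun k => I.encode.getD k 0) (fun _ _ => Nat.zero_le _)
    (Finset.mem_range.2 ?_)
  rw [inputLength_eq]
  have : (i + 1) * (I.n + 2) ≤ I.numSimplices * (I.n + 2) := Nat.mul_le_mul_right _ hi
  rw [Nat.succ_mul] at this
  omega

theorem face_eq_pair {k : ℕ} {u v : Fin I.n} (h : (I.face k).card = 2) (huv : u ≠ v)
    (hu : u ∈ I.face k) (hv : v ∈ I.face k) : I.face k = {u, v} := by
  refine (Finset.eq_of_subset_of_card_le ?_ ?_).symm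
  · simp [Finset.insert_subset_iff, hu, hv]
  · rw [h, Finset.card_pair huv]

theorem edgeLength_of_adj (u v : Fin I.n) (h : (oneSkeleton I.K).Adj u v) :
    I.edgeLength u v = I.len (edgeOfDart ⟨(u, v), h⟩) := by
  obtain ⟨-, hno⟩ | ⟨k, hk, ⟨h₁, h₂, h₃, h₄⟩, heq⟩ := iter_ite_eq (N := I.inputLength) (a := I.top)
    (f := I.atIndex I.len)
    (fun k => (I.face k).card = 2 ∧ u.1 ≠ v.1 ∧ I.bit k u ≠ 0 ∧ I.bit k v ≠ 0)
  · obtain ⟨k, hk, hface⟩ := exists_face_eq h.2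
    exact absurd ⟨by rw [hface, Finset.card_pair h.1], fun h' => h.1 (Fin.ext h'),
      mem_face_iff.2 (by simp [hface]), mem_face_iff.2 (by simp [hface])⟩
      (hno k (hk.trans_le numSimplices_le))
  · rw [edgeLength, heq]
    exact atIndex_eq _ _ (face_eq_pair h₁ h.1 (mem_face_iff.1 h₃) (mem_face_iff.1 h₄))

theorem adj_of_edgeLength_lt {u v : ℕ} (h : I.edgeLength u v < I.top) :
    ∃ u' v' : Fin I.n, u' = u ∧ v' = v ∧ (oneSkeleton I.K).Adj u' v' := by
  obtain ⟨heq, -⟩ | ⟨k, hk, ⟨h₁, h₂, h₃, h₄⟩, -⟩ := iter_ite_eq (N := I.inputLength) (a := I.top)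
    (f := I.atIndex I.len)
    (fun k => (I.face k).card = 2 ∧ u ≠ v ∧ I.bit k u ≠ 0 ∧ I.bit k v ≠ 0)
  · exact absurd heq h.ne
  · obtain ⟨u', hmem, rfl⟩ := bit_ne_zero_iff.1 h₃
    obtain ⟨v', hv', rfl⟩ := bit_ne_zero_iff.1 h₄
    have huv : u' ≠ v' := fun h => h₂ (congrArg _ h)
    refine ⟨u', v', rfl, rfl, huv, ?_⟩
    rw [← face_eq_pair h₁ huv hmem hv']
    exact face_mem ⟨_, hmem⟩

/-- The tables that depend on the input only have the right entries. -/
structure Prepared (I : Instance) (σ : Tables) : Prop where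
  bits : σ 0 = mkTable I.inputLength I.bit
  cycle : σ 2 = mkTable I.inputLength fun i _ => (I.atIndex I.z₀.1 i).val
  top : σ 4 = mkTable I.inputLength fun _ _ => I.top
  lengths : σ 5 = mkTable I.inputLength I.edgeLength
  matrix : σ 6 = mkTable I.inputLength I.boundaryEntry

theorem Prepared.congr {σ σ' : Tables} (h : Prepared I σ) (hσ : ∀ a < 7, σ' a = σ a) :
    Prepared I σ' :=
  ⟨(hσ 0 (by omega)).trans h.bits, (hσ 2 (by omega)).trans h.cycle, (hσ 4 (by omega)).trans h.top,
    (hσ 5 (by omega)).trans h.lengths, (hσ 6 (by omega)).trans h.matrix⟩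

@[simp] theorem eval_numVertices {σ : Tables} {env : List ℕ} :
    numVertices.eval I.encode σ env = I.n := rfl

@[simp] theorem eval_dimension {σ : Tables} {env : List ℕ} :
    dimension.eval I.encode σ env = I.d := rfl

@[simp] theorem eval_numSimplices {σ : Tables} {env : List ℕ} :
    Expr.numSimplices.eval I.encode σ env = I.numSimplices := rfl

theorem eval_position {σ : Tables} {env : List ℕ} {i : ℕ} (hi : i < I.inputLength) :
    position.eval I.encode σ (i :: env) = 3 + i * (I.n + 2) := by
  rw [position, eval_fold]
  -- The product `i * (n + 2)` is formed by adding `n + 2` in the first `i` of the `N` rounds; the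
  -- offset `3` skips the header of the input.
  have := iter_invariant (N := I.inputLength) (a := 3)
    (f := fun k x => if k < i then x + (I.n + 2) else x)
    (fun k x => x = 3 + min k i * (I.n + 2)) (by simp) (fun k hk x hx => by
      split_ifs with h
      · rw [hx, min_eq_left h.le, min_eq_left h, Nat.succ_mul, add_assoc]
      · rw [hx, min_eq_right (by omega), min_eq_right (by omega)]) _ le_rfl
  rw [min_eq_right hi.le] at this
  simpa using this

/-- The accumulator starts at `1` and drops to `0` at the first vertex of simplex `j` that is
missing from simplex `i`. -/
theorem iter_subset (i j : ℕ) :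
    iter (fun k x => if I.bit j k ≠ 0 then if I.bit i k ≠ 0 then x else 0 else x) 1 I.inputLength =
      if I.face j ⊆ I.face i then 1 else 0 := by
  have h := iter_ite_eq (N := I.inputLength) (a := 1) (f := fun _ => 0)
    (fun k => I.bit j k ≠ 0 ∧ ¬ I.bit i k ≠ 0)
  rw [iter_congr (g := fun k x => if I.bit j k ≠ 0 ∧ ¬ I.bit i k ≠ 0 then 0 else x)]
  · obtain ⟨h₁, h₂⟩ | ⟨k, hk, ⟨h₁, h₂⟩, h₃⟩ := h
    · rw [h₁, if_pos]
      intro v hv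
      by_contra hv'
      exact h₂ v (v.2.trans_le n_le_inputLength)
        ⟨mem_face_iff.2 hv, fun h => hv' (mem_face_iff.1 h)⟩
    · rw [h₃, if_neg]
      intro hsub
      obtain ⟨v, hv, rfl⟩ := bit_ne_zero_iff.1 h₁
      exact h₂ (mem_face_iff.2 (hsub hv))
  · intro k _ x
    split_ifs <;> first | rfl | tauto

theorem exec_prepare : Prepared I (Cmd.prepare.exec I.encode [] 0) ∧
    Cmd.prepare.exec I.encode [] 0 16 0 0 = I.top ∧
    ∀ i, Cmd.prepare.exec I.encode [] 0 17 i 0 = (I.atIndex I.z₀.1 i).val := by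
  have hN : 0 < I.encode.length := inputLength_pos
  have hbeyond : ∀ {M : Type} [Zero M] {k : ℕ} (f : Simplex I.K k → M) {i : ℕ},
      ¬ i < I.numSimplices → I.atIndex f i = 0 := fun f i hi => dif_neg hi
  have key : Cmd.prepare.exec I.encode [] 0 = Function.update (Function.update (Function.update
      (Function.update (Function.update (Function.update (Function.update (Function.update
      (Function.update (Function.update (0 : Tables) 0 (mkTable I.inputLength I.bit))
      1 (mkTable I.inputLength fun i _ => I.atIndex I.len i))
      2 (mkTable I.inputLength fun i _ => (I.atIndex I.z₀.1 i).val))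
      3 (mkTable I.inputLength fun i _ => (I.face i).card))
      18 (mkTable I.inputLength fun _ _ => I.lengthBound))
      4 (mkTable I.inputLength fun _ _ => I.top))
      5 (mkTable I.inputLength I.edgeLength))
      6 (mkTable I.inputLength I.boundaryEntry))
      16 (mkTable I.inputLength fun _ _ => I.top))
      17 (mkTable I.inputLength fun i _ => (I.atIndex I.z₀.1 i).val) := by
    rw [Cmd.prepare]
    -- Unfolds sequencing only, so that each assignment can be replaced by its intended table.
    simp only [Cmd.exec.eq_2]
    rw [Cmd.exec_assign (a := 0) I.bit fun i hi j hj => ?bits,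
      Cmd.exec_assign (a := 1) (fun i _ => I.atIndex I.len i) fun i hi j hj => ?lens,
      Cmd.exec_assign (a := 2) (fun i _ => (I.atIndex I.z₀.1 i).val) fun i hi j hj => ?cyc,
      Cmd.exec_assign (a := 3) (fun i _ => (I.face i).card) fun i hi j hj => ?card,
      Cmd.exec_assign (a := 18) (fun _ _ => I.lengthBound) fun i hi j hj => ?bound,
      Cmd.exec_assign (a := 4) (fun _ _ => I.top) fun i hi j hj => ?top,
      Cmd.exec_assign (a := 5) I.edgeLength fun i hi j hj => ?edge,
      Cmd.exec_assign (a := 6) I.boundaryEntry fun i hi j hj => ?matrix,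
      Cmd.exec_assign (a := 16) (fun _ _ => I.top) fun i hi j hj => ?best,
      Cmd.exec_assign (a := 17) (fun i _ => (I.atIndex I.z₀.1 i).val) fun i hi j hj => ?out]
    case bits =>
      simp only [eval_ite, eval_and_ne_zero, eval_lt_ne_zero, eval_var_zero, eval_var_one,
        eval_numSimplices, eval_numVertices, eval_input, eval_add, eval_position hi, eval_const]
      split_ifs with h
      · exact getD_bit h.1 h.2
      · exact (bit_eq_zero_of_le (by omega)).symm
    case lens =>
      simp only [eval_ite, eval_lt_ne_zero, eval_var_zero,
        eval_numSimplices, eval_numVertices, eval_input, eval_add, eval_position hi, eval_const]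
      split_ifs with h
      · exact getD_len h
      · exact (hbeyond _ h).symm
    case cyc =>
      simp only [eval_ite, eval_lt_ne_zero, eval_var_zero,
        eval_numSimplices, eval_numVertices, eval_input, eval_add, eval_position hi, eval_const]
      split_ifs with h
      · exact getD_cycle h
      · rw [hbeyond _ h, ZMod.val_zero]
    case card =>
      simp only [eval_fold, eval_add, eval_var_zero, eval_var_one, eval_var_two, eval_load,
        eval_const]
      rw [iter_add, zero_add, ← sum_bit i n_le_inputLength]
      refine Finset.sum_congr rfl fun k hk => ?_
      simp [mkTable_of_lt hi (Finset.mem_range.1 hk)]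
    case bound =>
      simp only [eval_fold, eval_add, eval_var_zero, eval_var_one, eval_input, eval_const]
      rw [iter_add, zero_add]
      rfl
    case top =>
      simp only [eval_fold, eval_add, eval_var_zero, eval_load₀, eval_const, Function.update_self,
        mkTable_of_lt hN hN]
      rw [iter_add, Finset.sum_const, Finset.card_range]
      rfl
    case edge =>
      simp only [eval_fold]
      rw [edgeLength]
      simp only [eval_load₀, Function.update_self, mkTable_of_lt hN hN]
      refine iter_congr fun k hk x => ?_
      simp only [eval_ite, eval_ne_ne_zero, eval_and_ne_zero, eval_load₁, eval_load, eval_var_zero,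
        eval_var_one, eval_var_two, eval_var_three, eval_const, ne_eq, Nat.reduceEqDiff,
        OfNat.zero_ne_ofNat, not_false_eq_true, Function.update_of_ne, Function.update_self,
        mkTable_of_lt hk hN, mkTable_of_lt hk hi, mkTable_of_lt hk hj]
      split_ifs <;> first | rfl | tauto
    case matrix =>
      simp only [eval_ite, eval_ne_ne_zero, eval_load₁, eval_load, eval_fold, eval_var_zero,
        eval_var_one, eval_var_two, eval_var_three, eval_const, eval_add, eval_dimension,
        ne_eq, Nat.reduceEqDiff, OfNat.zero_ne_ofNat, zero_ne_one, not_false_eq_true,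
        Function.update_of_ne, Function.update_self, mkTable_of_lt hi hN, mkTable_of_lt hj hN]
      rw [iter_congr (g := fun k x => if I.bit j k ≠ 0 then if I.bit i k ≠ 0 then x else 0 else x)
        fun k hk x => by rw [mkTable_of_lt hj hk, mkTable_of_lt hi hk], iter_subset, boundaryEntry]
      split_ifs <;> first | rfl | tauto
    case best => simp [mkTable_of_lt hN hN]
    case out => simp [mkTable_of_lt hi hN]
  rw [key]
  refine ⟨⟨by simp, by simp, by simp, by simp, by simp⟩, by simp [mkTable_of_lt hN hN],
    fun i => ?_⟩
  by_cases hi : i < I.inputLength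
  · simp [mkTable_of_lt hi hN]
  · rw [hbeyond _ fun h => hi (h.trans_le numSimplices_le)]
    simp [mkTable, hi]

end Instance

end CycleLocalization

namespace CycleLocalization

namespace Instance

/-! ### Distances, elimination and comparison of centers in the tables. -/

variable {I : Instance}

theorem exec_distances {σ : Tables} {env : List ℕ} (hσ : Prepared I σ) (p : Fin I.n) :
    ∃ D : ℕ → ℕ → ℕ, Relaxation I.len I.inputLength I.top I.edgeLength p D ∧
      ∀ v, Cmd.distances.exec I.encode (p :: env) σ 7 v 0 = D I.inputLength v := by
  have hN : 0 < I.encode.length := inputLength_pos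
  set σ₀ := (Cmd.assign 7 (.ite (Expr.ne (.var 0) (.var 2)) (load₀ 4) (.const 0))).exec I.encode
    (p :: env) σ with hσ₀
  have h₀ : σ₀ = Function.update σ 7
      (mkTable I.inputLength fun i _ => if i = p then 0 else I.top) := by
    refine Cmd.exec_assign _ fun i hi j hj => ?_
    simp [hσ.top, mkTable_of_lt hN hN]
  set τ : ℕ → Tables := fun k =>
    iter (fun k σ => Cmd.relax.exec I.encode (k :: p :: env) σ) σ₀ k with hτ
  have h5 : ∀ k, τ k 5 = mkTable I.inputLength I.edgeLength := fun k =>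
    iter_invariant (N := k) (fun (_ : ℕ) (σ' : Tables) => σ' 5 = mkTable I.inputLength I.edgeLength)
      (by simp [h₀, hσ.lengths])
      (fun k _ x hx => by rw [Cmd.exec_of_notMem _ (by decide), hx]) k le_rfl
  have hstep : ∀ k, ∀ v < I.inputLength, τ (k + 1) 7 v 0 =
      iter (fun u x => if τ k 7 u 0 + τ k 5 u v < x then τ k 7 u 0 + τ k 5 u v else x) (τ k 7 v 0)
        I.inputLength := by
    intro k v hv
    change Cmd.relax.exec I.encode (k :: p :: env) (τ k) 7 v 0 = _
    rw [Cmd.exec_relax, Function.update_self, mkTable_of_lt hv hN]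
  refine ⟨fun k v => τ k 7 v 0, ⟨n_le_inputLength, edgeLength_of_adj,
    fun u _ v _ h => adj_of_edgeLength_lt h, fun v hv => ?_, fun k _ v hv => ?_,
    fun k _ v hv u hu => ?_, fun k _ v hv => ?_⟩, fun v => rfl⟩
  · change σ₀ 7 v 0 = _
    rw [h₀, Function.update_self, mkTable_of_lt hv hN]
  · have := hstep k v hv
    exact (le_iter_min_iff.1 this.le).1
  · have := (le_iter_min_iff.1 (hstep k v hv).le).2 u hu
    rwa [h5, mkTable_of_lt hu hv] at this
  · obtain h | ⟨u, hu, h⟩ := iter_min_eq (N := I.inputLength) (a := τ k 7 v 0)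
      (f := fun u => τ k 7 u 0 + τ k 5 u v)
    · exact .inl ((hstep k v hv).trans h)
    · refine .inr ⟨u, hu, (hstep k v hv).trans (h.trans ?_)⟩
      simp only [h5, mkTable_of_lt hu hv]

/-- The state of the elimination in the tables after `k` steps. -/
structure Eliminated (I : Instance) (W : ℕ → ℕ) (k : ℕ) (σ : Tables) : Prop where
  weight : ∀ i, σ 8 i 0 = W i
  outside : ∀ a i j, ¬ (i < I.inputLength ∧ j < I.inputLength) → σ a i j = 0
  matrix_le : ∀ i j, σ 9 i j ≤ 1
  cycle_le : ∀ i, σ 10 i 0 ≤ 1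
  state : EliminationState I.boundaryVectors (I.chainVector _ I.z₀.1) W
    (fun i j => (σ 9 i j : ZMod 2)) (fun i => (σ 10 i 0 : ZMod 2)) {i | σ 11 i 0 ≠ 0}
  card_le : k ≤ ((Finset.range I.inputLength).filter fun i => σ 11 i 0 ≠ 0).card

theorem Eliminated.step {W : ℕ → ℕ} {k : ℕ} {σ : Tables} {env : List ℕ}
    (h : Eliminated I W k σ) (hk : k < I.inputLength) :
    Eliminated I W (k + 1) (Cmd.eliminate.exec I.encode env σ) := by
  have hN : 0 < I.encode.length := inputLength_pos
  obtain ⟨s, hs, t, ht, hsmax, htmax, h9, h10, h11⟩ :=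
    Cmd.exec_eliminate (w := I.encode) (σ := σ) (env := env) hN
  have hout := Cmd.exec_zero_outside (env := env) Cmd.eliminate h.outside
  set σ' := Cmd.eliminate.exec I.encode env σ with hσ'
  have h11' : ∀ i, σ' 11 i 0 = if i = s then 1 else σ 11 i 0 := by
    intro i
    by_cases hi : i < I.inputLength
    · exact h11 i hi
    · rw [hout _ _ _ fun h => hi h.1, h.outside _ _ _ fun h => hi h.1,
        if_neg (by rintro rfl; exact hi hs)]
  have h9' : ∀ i j, (σ' 9 i j : ZMod 2) = σ 9 i j + σ 9 i s * σ 9 t j := by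
    intro i j
    by_cases hi : i < I.inputLength
    · by_cases hj : j < I.inputLength
      · rw [h9 i hi j hj, cast_bitXor (h.matrix_le _ _) (bitAnd_le_one (h.matrix_le _ _)),
          cast_bitAnd (h.matrix_le _ _)]
      · rw [hout _ _ _ fun h => hj h.2, h.outside _ i j fun h => hj h.2,
          h.outside _ t j fun h => hj h.2]
        simp
    · rw [hout _ _ _ fun h => hi h.1, h.outside _ i j fun h => hi h.1,
        h.outside _ i s fun h => hi h.1]
      simp
  have h10' : ∀ i, (σ' 10 i 0 : ZMod 2) = σ 10 i 0 + σ 10 s 0 * σ 9 t s * σ 9 t i := by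
    intro i
    by_cases hi : i < I.inputLength
    · rw [h10 i hi, cast_bitXor (h.cycle_le _) (bitAnd_le_one (h.matrix_le _ _)),
        cast_bitAnd (bitAnd_le_one (h.matrix_le _ _)), cast_bitAnd (h.cycle_le _)]
    · rw [hout _ _ _ fun h => hi h.1, h.outside _ i 0 fun h => hi h.1,
        h.outside _ t i fun h => hi h.2]
      simp
  refine ⟨fun i => ?_, hout, fun i j => ?_, fun i => ?_, ?_, ?_⟩
  · rw [hσ', Cmd.exec_of_notMem _ (by decide), h.weight]
  · by_cases hij : i < I.inputLength ∧ j < I.inputLength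
    · rw [h9 i hij.1 j hij.2]
      exact bitXor_le_one (bitAnd_le_one (h.matrix_le _ _))
    · rw [hout _ _ _ hij]
      omega
  · by_cases hi : i < I.inputLength
    · rw [h10 i hi]
      exact bitXor_le_one (bitAnd_le_one (h.matrix_le _ _))
    · rw [hout _ _ _ fun h => hi h.1]
      omega
  -- Column `s` has the highest priority, hence the largest weight among untreated coordinates. Row
  -- `t` maximizes a column of bits, so it has a `1` there if any row has.
  · have hst := h.state.step (s := s) (t := t) ?_ ?_
    · convert hst using 1
      · funext i j
        simp [h9']
      · funext i
        simp [h10']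
      · ext i
        by_cases his : i = s <;> simp [h11', his]
    · rintro r hr ⟨y, hy, hyr⟩
      have := hsmax r (lt_of_mem_boundaryVectors hy hyr)
      rw [if_neg (show ¬ σ 11 r 0 ≠ 0 from hr)] at this
      rw [← h.weight, ← h.weight]
      split_ifs at this <;> omega
    · intro i hi
      rw [natCast_zmod_two_ne_zero (h.matrix_le _ _)] at hi ⊢
      have hiN : i < I.inputLength := by
        by_contra h'
        exact hi (h.outside _ _ _ fun h => h' h.1)
      have := htmax i hiN
      omega
  -- Either a new coordinate is treated, or the highest priority is `0` and all coordinates were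
  -- treated already. In both cases at least `k + 1` are treated afterwards.
  · by_cases hs0 : σ 11 s 0 = 0
    · refine (Nat.succ_le_succ h.card_le).trans ?_
      rw [Nat.succ_eq_add_one, ← Finset.card_insert_of_notMem (a := s) (by simp [hs0])]
      refine Finset.card_le_card fun i hi => ?_
      rw [Finset.mem_filter, Finset.mem_range, h11']
      obtain rfl | hi := Finset.mem_insert.1 hi
      · simpa using hs
      · rw [Finset.mem_filter, Finset.mem_range] at hi
        refine ⟨hi.1, ?_⟩
        split_ifs
        · exact one_ne_zero
        · exact hi.2
    · rw [Finset.filter_true_of_mem, Finset.card_range]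
      · exact hk
      · intro i hi
        rw [h11']
        split_ifs
        · exact one_ne_zero
        · intro hi0
          have := hsmax i (Finset.mem_range.1 hi)
          rw [if_pos hs0, if_neg (by simpa using hi0)] at this
          omega

/-- The reduced cycle has the least weight among all representatives, and table `15` holds its
weight. -/
theorem exec_reduce {σ : Tables} {env : List ℕ} (hσ : Prepared I σ)
    (hout : ∀ a i j, ¬ (i < I.inputLength ∧ j < I.inputLength) → σ a i j = 0) :
    let σ' := Cmd.reduce.exec I.encode env σ
    (∀ i, σ' 10 i 0 ≤ 1) ∧
    ((fun i => (σ' 10 i 0 : ZMod 2)) - I.chainVector _ I.z₀.1 ∈ I.boundaryVectors) ∧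
    (∀ i, σ' 10 i 0 ≠ 0 → ∀ q ∈ I.face i, σ 7 q.1 0 ≤ σ' 15 0 0) ∧
    ∀ z' : ℕ → ZMod 2, z' - I.chainVector _ I.z₀.1 ∈ I.boundaryVectors → ∀ x,
      (∀ i, z' i ≠ 0 → ∀ q ∈ I.face i, σ 7 q.1 0 ≤ x) → σ' 15 0 0 ≤ x := by
  intro σ'
  have hN : 0 < I.encode.length := inputLength_pos
  set weightExpr : Expr := maximum (.ite (.load 0 (.var 2) (.var 1)) (load₁ 7 (.var 1)) (.const 0))
  set W : ℕ → ℕ := fun i =>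
    mkTable I.inputLength (fun i j => weightExpr.eval I.encode σ (i :: j :: env)) i 0 with hW
  have hWle : ∀ i < I.inputLength, ∀ x, W i ≤ x ↔ ∀ q ∈ I.face i, σ 7 q.1 0 ≤ x := by
    intro i hi x
    rw [hW]
    simp only [mkTable_of_lt hi hN]
    rw [Cmd.eval_maximum_le_iff (f := fun v => if I.bit i v ≠ 0 then σ 7 v 0 else 0)]
    · constructor
      · intro h q hq
        have := h q (q.2.trans_le n_le_inputLength)
        rwa [if_pos (mem_face_iff.2 hq)] at this
      · intro h v hv
        split_ifs with hb
        · obtain ⟨q, hq, rfl⟩ := bit_ne_zero_iff.1 hb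
          exact h q hq
        · exact Nat.zero_le _
    · intro v hv x
      simp [hσ.bits, mkTable_of_lt hi hv]
  set σ₀ := Function.update (Function.update (Function.update (Function.update σ
    8 (mkTable I.inputLength fun i j => weightExpr.eval I.encode σ (i :: j :: env)))
    9 (mkTable I.inputLength I.boundaryEntry))
    10 (mkTable I.inputLength fun i _ => (I.atIndex I.z₀.1 i).val))
    11 (mkTable I.inputLength fun _ _ => 0) with hσ₀
  set σ₁ := (Cmd.loop Cmd.eliminate).exec I.encode env σ₀ with hσ₁
  have hσ'₁ : σ' = (Cmd.assign 15 (maximum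
      (.ite (load₁ 10 (.var 1)) (load₁ 8 (.var 1)) (.const 0)))).exec I.encode env σ₁ := by
    rw [hσ₁, hσ₀]
    simp only [σ', Cmd.reduce, Cmd.exec.eq_2]
    rw [Cmd.exec_assign (a := 8) _ fun i _ j _ => rfl,
      Cmd.exec_assign (a := 9) I.boundaryEntry fun i hi j hj => by
        simp [hσ.matrix, mkTable_of_lt hi hj],
      Cmd.exec_assign (a := 10) (fun i _ => (I.atIndex I.z₀.1 i).val) fun i hi j hj => by
        simp [hσ.cycle, mkTable_of_lt hi hN],
      Cmd.exec_assign (a := 11) (fun _ _ => 0) fun i hi j hj => by simp]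
  have hval : ∀ i, mkTable I.inputLength (fun i _ => (I.atIndex I.z₀.1 i).val) i 0 =
      (I.atIndex I.z₀.1 i).val := by
    intro i
    by_cases hi : i < I.inputLength
    · exact mkTable_of_lt hi hN
    · rw [mkTable, if_neg fun h => hi h.1, atIndex_of_card_ne _ fun h =>
        absurd (h.trans_le numSimplices_le) hi, ZMod.val_zero]
  -- Cutting off at `N` loses nothing: positions beyond the list carry the empty face, whose
  -- cardinality is never `d + 1` or `d + 2`.
  have hent : ∀ i j, mkTable I.inputLength I.boundaryEntry i j = I.boundaryEntry i j := by
    intro i j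
    by_cases hij : i < I.inputLength ∧ j < I.inputLength
    · exact if_pos hij
    · rw [mkTable, if_neg hij, boundaryEntry, if_neg]
      rintro ⟨h₁, h₂, -⟩
      refine hij ⟨lt_of_lt_of_le ?_ numSimplices_le, lt_of_lt_of_le ?_ numSimplices_le⟩ <;>
      · by_contra h
        rw [face_of_le (not_lt.1 h), Finset.card_empty] at *
        omega
  have helim : Eliminated I W I.inputLength σ₁ := by
    refine iter_invariant (N := I.inputLength) (fun k σ => Eliminated I W k σ) ?_
      (fun k hk x hx => hx.step hk) _ le_rfl
    refine ⟨fun i => by simp [hσ₀, hW], fun a i j hij => ?_, fun i j => ?_, fun i => ?_, ?_,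
      Nat.zero_le _⟩
    · simp only [hσ₀, Function.update_apply]
      split_ifs <;> first | exact if_neg hij | exact hout _ _ _ hij
    · simp only [hσ₀, ne_eq, Nat.reduceEqDiff, not_false_eq_true, Function.update_of_ne,
        Function.update_self, hent, boundaryEntry]
      split_ifs <;> omega
    · simp only [hσ₀, ne_eq, Nat.reduceEqDiff, not_false_eq_true, Function.update_of_ne,
        Function.update_self, hval]
      exact Nat.lt_succ_iff.1 (ZMod.val_lt _)
    · convert EliminationState.initial (W := W) (z := I.chainVector _ I.z₀.1)
        (span_boundaryEntry (I := I)) using 1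
      · funext i j
        simp [hσ₀, hent]
      · funext i
        simp only [hσ₀, ne_eq, Nat.reduceEqDiff, not_false_eq_true, Function.update_of_ne,
          Function.update_self, hval, ZMod.natCast_zmod_val]
        rfl
      · ext i
        simp [hσ₀, mkTable]
  have h10 : ∀ i, σ' 10 i 0 = σ₁ 10 i 0 := fun i => by
    rw [hσ'₁, Cmd.exec_of_notMem _ (by decide)]
  have h15 : ∀ x, σ' 15 0 0 ≤ x ↔ ∀ i, σ' 10 i 0 ≠ 0 → ∀ q ∈ I.face i, σ 7 q.1 0 ≤ x := by
    intro x
    rw [hσ'₁, Cmd.exec_assign (a := 15) _ fun i _ j _ => rfl, Function.update_self,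
      mkTable_of_lt hN hN,
      Cmd.eval_maximum_le_iff (f := fun i => if σ₁ 10 i 0 ≠ 0 then W i else 0)]
    · simp only [ne_eq, Nat.reduceEqDiff, not_false_eq_true, Function.update_of_ne]
      constructor
      · intro h i hi
        have hiN : i < I.inputLength := by
          by_contra h'
          exact hi (helim.outside _ _ _ fun h => h' h.1)
        have := h i hiN
        rw [if_pos hi, hWle i hiN] at this
        exact this
      · intro h i hiN
        split_ifs with hi
        · exact Nat.zero_le _
        · exact (hWle i hiN x).2 (h i hi)
    · intro i hi x
      simp [helim.weight]
  refine ⟨fun i => (h10 i).le.trans (helim.cycle_le i), ?_, (h15 _).1 le_rfl, ?_⟩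
  · simp only [h10]
    exact helim.state.coset
  · intro z' hz' x hx
    -- After `N` steps at least `N` of the `N` coordinates are treated, that is, all of them, and
    -- boundaries live on these.
    have hall : ∀ y ∈ I.boundaryVectors, ∀ r, y r ≠ 0 → r ∈ {i | σ₁ 11 i 0 ≠ 0} := by
      intro y hy r hr
      have heq := Finset.eq_of_subset_of_card_le (Finset.filter_subset
        (fun i => σ₁ 11 i 0 ≠ 0) (Finset.range I.inputLength))
        (by rw [Finset.card_range]; exact helim.card_le)
      have := lt_of_mem_boundaryVectors hy hr
      rw [← Finset.mem_range, ← heq, Finset.mem_filter] at this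
      exact this.2
    rw [h15]
    intro i hi
    have hiN : i < I.inputLength := by
      by_contra h'
      rw [h10] at hi
      exact hi (helim.outside _ _ _ fun h => h' h.1)
    rw [← hWle i hiN]
    obtain ⟨s, hs, hle⟩ := helim.state.final hall hz' (r := i)
      ((natCast_zmod_two_ne_zero (helim.cycle_le i)).2 (by rwa [← h10]))
    refine hle.trans ?_
    by_cases hsN : s < I.inputLength
    · exact (hWle s hsN x).2 (hx s hs)
    · simp [hW, mkTable, hsN]

/-! ### The minimum over all centers. -/

/-- The result after the centers below `p` have been treated. -/
structure BestSoFar (I : Instance) (p : ℕ) (σ : Tables) : Prop where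
  prepared : Prepared I σ
  outside : ∀ a i j, ¬ (i < I.inputLength ∧ j < I.inputLength) → σ a i j = 0
  cycle_le : ∀ i, σ 17 i 0 ≤ 1
  coset : (fun i => (σ 17 i 0 : ZMod 2)) - I.chainVector _ I.z₀.1 ∈ I.boundaryVectors
  le_top : σ 16 0 0 ≤ I.top
  attained : σ 16 0 0 < I.top → ∃ c, ∀ i, σ 17 i 0 ≠ 0 → ∀ q ∈ I.face i,
    geodist I.len c q ≤ σ 16 0 0
  le : ∀ c : Fin I.n, c.1 < p → ∀ z' : ℕ → ZMod 2,
    z' - I.chainVector _ I.z₀.1 ∈ I.boundaryVectors → ∀ x : ℕ,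
      (∀ i, z' i ≠ 0 → ∀ q ∈ I.face i, geodist I.len c q ≤ x) → σ 16 0 0 ≤ x ∧ σ 16 0 0 < I.top

theorem BestSoFar.step {p : ℕ} {σ : Tables} {env : List ℕ} (h : BestSoFar I p σ) :
    BestSoFar I (p + 1) (Cmd.treatCenter.exec I.encode (p :: env) σ) := by
  have hN : 0 < I.encode.length := inputLength_pos
  have hout' := Cmd.exec_zero_outside (env := p :: env) Cmd.treatCenter h.outside
  have hprep' : Prepared I (Cmd.treatCenter.exec I.encode (p :: env) σ) :=
    h.prepared.congr fun a ha => Cmd.exec_of_notMem _ (by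
      simp only [Cmd.treatCenter, Cmd.distances, Cmd.reduce, Cmd.keepBest, Cmd.relax,
        Cmd.eliminate, Cmd.writes, List.mem_append, List.mem_singleton]
      omega)
  set σ₁ := Cmd.distances.exec I.encode (p :: env) σ with hσ₁
  set σ₂ := Cmd.reduce.exec I.encode (p :: env) σ₁ with hσ₂
  have hprep₁ : Prepared I σ₁ := h.prepared.congr fun a ha => Cmd.exec_of_notMem _ (by
    simp only [Cmd.distances, Cmd.relax, Cmd.writes, List.mem_append, List.mem_singleton]
    omega)
  obtain ⟨hZle, hZ, hR, hRle⟩ := exec_reduce (env := p :: env) hprep₁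
    (Cmd.exec_zero_outside Cmd.distances h.outside)
  rw [← hσ₂] at hZle hZ hR hRle
  have h16 : ∀ i, σ₂ 16 i 0 = σ 16 i 0 := fun i => by
    rw [hσ₂, Cmd.exec_of_notMem _ (by decide), hσ₁, Cmd.exec_of_notMem _ (by decide)]
  have h17 : ∀ i, σ₂ 17 i 0 = σ 17 i 0 := fun i => by
    rw [hσ₂, Cmd.exec_of_notMem _ (by decide), hσ₁, Cmd.exec_of_notMem _ (by decide)]
  have hz₂ := Cmd.exec_zero_outside (env := p :: env) Cmd.reduce
    (Cmd.exec_zero_outside (env := p :: env) Cmd.distances h.outside)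
  rw [← hσ₁, ← hσ₂] at hz₂
  -- The loop runs over all `p < N`; values `p ≥ n` are not vertices and are ignored here.
  set better : Prop := p < I.n ∧ σ₂ 15 0 0 < σ 16 0 0 with hbetter
  have hfin : Cmd.treatCenter.exec I.encode (p :: env) σ = Function.update (Function.update σ₂
      17 (mkTable I.inputLength fun i _ => if better then σ₂ 10 i 0 else σ 17 i 0))
      16 (mkTable I.inputLength fun _ _ => if better then σ₂ 15 0 0 else σ 16 0 0) := by
    rw [Cmd.treatCenter, Cmd.keepBest]
    simp only [Cmd.exec.eq_2]
    rw [← hσ₁, ← hσ₂,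
      Cmd.exec_assign (a := 17) (fun i _ => if better then σ₂ 10 i 0 else σ 17 i 0)
        fun i hi j hj => ?_,
      Cmd.exec_assign (a := 16) (fun _ _ => if better then σ₂ 15 0 0 else σ 16 0 0)
        fun i hi j hj => ?_]
    · simp only [eval_ite, eval_and_ne_zero, eval_lt_ne_zero, eval_var_two, eval_numVertices,
        eval_load₀, h16, ne_eq, Nat.reduceEqDiff, not_false_eq_true, Function.update_of_ne]
      rfl
    · simp only [eval_ite, eval_and_ne_zero, eval_lt_ne_zero, eval_var_two, eval_numVertices,
        eval_load₀, eval_load₁, eval_var_zero, h16, h17]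
      rfl
  set σ' := Cmd.treatCenter.exec I.encode (p :: env) σ with hσ'
  have hout17 : ∀ i, σ' 17 i 0 = if better then σ₂ 10 i 0 else σ 17 i 0 := by
    intro i
    by_cases hi : i < I.inputLength
    · simp [hfin, mkTable_of_lt hi hN]
    · rw [hout' _ _ _ fun h => hi h.1, hz₂ _ _ _ fun h => hi h.1, h.outside _ _ _ fun h => hi h.1,
        ite_self]
  have hout16 : σ' 16 0 0 = if better then σ₂ 15 0 0 else σ 16 0 0 := by
    simp [hfin, mkTable_of_lt hN hN]
  have hlt : σ' 16 0 0 ≤ σ 16 0 0 := by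
    rw [hout16]
    split_ifs with hb
    · exact hb.2.le
    · exact le_rfl
  refine ⟨hprep', hout', fun i => ?_, ?_, hlt.trans h.le_top, ?_, ?_⟩
  · rw [hout17]
    split_ifs
    · exact hZle i
    · exact h.cycle_le i
  · simp only [hout17]
    split_ifs
    · exact hZ
    · exact h.coset
  · rw [hout16]
    simp only [hout17]
    split_ifs with hb
    · intro htop
      obtain ⟨D, hD, hD7⟩ := exec_distances (env := env) h.prepared ⟨p, hb.1⟩
      refine ⟨⟨p, hb.1⟩, fun i hi q hq => ?_⟩
      have := hR i hi q hq
      rw [hσ₁, hD7] at this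
      -- Estimates below `top` come from actual walks, so they bound true distances from above.
      exact (hD.geodist_le (this.trans_lt htop)).trans (Nat.cast_le.2 this)
    · exact h.attained
  · intro c hc z' hz' x hx
    obtain hcp | hcp := Nat.lt_succ_iff_lt_or_eq.1 hc
    · obtain ⟨h₁, h₂⟩ := h.le c hcp z' hz' x hx
      exact ⟨hlt.trans h₁, hlt.trans_lt h₂⟩
    · obtain ⟨D, hD, hD7⟩ := exec_distances (env := env) h.prepared c
      rw [hcp, ← hσ₁] at hD7
      have hle : σ' 16 0 0 ≤ σ₂ 15 0 0 := by
        rw [hout16]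
        split_ifs with hb
        · exact le_rfl
        · by_contra h'
          exact hb ⟨hcp ▸ c.2, not_le.1 h'⟩
      refine ⟨hle.trans (hRle z' hz' x fun i hi q hq => ?_), hle.trans_lt ?_⟩
      · rw [hD7]
        exact Nat.cast_le.1 ((hD.le_geodist q).trans (hx i hi q hq))
      -- The bound `x` may itself exceed `top`. But it makes all distances involved finite, so their
      -- estimates are at most `top - 1`, and the optimality of the reduced cycle is applied with
      -- that bound.
      · refine Nat.lt_of_le_sub_one (by rw [top]; omega)
          (hRle z' hz' (I.top - 1) fun i hi q hq => ?_)
        rw [hD7]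
        refine Nat.le_sub_one_of_lt (hD.lt_top len_le_lengthBound (by rw [top]; omega) ?_)
        exact ne_top_of_le_ne_top (ENat.natCast_ne_top x) (hx i hi q hq)

theorem bestSoFar_minRadiusCycle :
    BestSoFar I I.inputLength (Cmd.minRadiusCycle.exec I.encode [] 0) := by
  refine iter_invariant (N := I.inputLength) (fun p σ => BestSoFar I p σ) ?_
    (fun k _ x hx => hx.step) _ le_rfl
  obtain ⟨h₁, h₂, h₃⟩ := exec_prepare (I := I)
  refine ⟨h₁, Cmd.exec_zero_outside _ fun _ _ _ _ => rfl, fun i => ?_, ?_, h₂.le, ?_, ?_⟩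
  · rw [h₃]
    exact Nat.lt_succ_iff.1 (ZMod.val_lt _)
  · simp only [h₃, ZMod.natCast_zmod_val]
    convert zero_mem I.boundaryVectors using 1
    exact sub_self _
  -- No center has been tried yet: the best weight is `top`, so nothing need be attained.
  · intro h
    exact absurd h (by rw [h₂]; exact lt_irrefl _)
  · intro c hc
    exact absurd hc (Nat.not_lt_zero _)

/-- The algorithm computes a representative cycle of minimal radius. -/
theorem solution_minRadiusCycle (I : Instance) :
    I.Solution ((List.range I.numSimplices).map fun i =>
      Cmd.minRadiusCycle.exec I.encode [] 0 17 i 0) := by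
  have h := bestSoFar_minRadiusCycle (I := I)
  set σ := Cmd.minRadiusCycle.exec I.encode [] 0
  obtain ⟨z, hz, hvec⟩ := exists_minRadiusCycle (best := σ 16 0 0) (top := I.top) h.coset
    (fun hlt => by
      obtain ⟨c, hc⟩ := h.attained hlt
      exact ⟨c, fun i hi => hc i ((natCast_zmod_two_ne_zero (h.cycle_le i)).1 hi)⟩)
    (fun c => h.le c (c.2.trans_le n_le_inputLength))
  refine ⟨z, hz, List.ext_getElem (by simp [encodeCycle]) fun i h₁ h₂ => ?_⟩
  have hi : i < I.numSimplices := by simpa using h₁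
  have hzi : valueAt z.1 I.simplices[i] = (σ 17 i 0 : ZMod 2) := by
    rw [← congrFun hvec i]
    change _ = I.atIndex z.1 i
    rw [atIndex, dif_pos hi]
  simp only [encodeCycle, List.getElem_map, List.getElem_range, hzi]
  rw [ZMod.val_natCast_of_lt (Nat.lt_succ_of_le (h.cycle_le i))]

end Instance

end CycleLocalization

/-- A representative cycle of minimal radius of a given mod 2 homology class of a finite simplicial
complex can be computed in polynomial time. -/
theorem mainTheorem4 :
    RAM.PolyTimeSolvable CycleLocalization.Instance.encode CycleLocalization.Instance.Solution := by
  exact RAM.polyTimeSolvable_of_cmd RAM.Cmd.minRadiusCycle 17 RAM.Expr.numSimplices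
    (fun _ => CycleLocalization.Instance.numSimplices_le)
    CycleLocalization.Instance.solution_minRadiusCycle
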